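/- **Model.** A fully connected system has $n$ nodes, at most $f=\lfloor (n-1)/3\rfloor$ of which are Byzantine; $C$ is the set of correct nodes. A pulse sent by a correct node at time $s$ is received by each correct node (including the sender) at some time in $[s+d-U,s+d]$, where $0\le U\le d$; faulty nodes may send arbitrary pulses to each node, finitely many in bounded time, and receivers know the sender. Each $v\in C$ has a hardware clock $H_v:\mathbb R_{\ge 0}\to\mathbb R_{\ge 0}$, differentiable with derivative $h_v$, such that $1\le h_v\le\vartheta$ and $|h_v(t')-h_v(t)|\le\nu|t'-t|$, where $\vartheta>1$ and $\nu>0$; moreover $H_v(0)\in[0,F)$. **Algorithm** (at $v\in C$; parameters $\tau_1,\tau_2,\tau_3,\tau_4,T,\varepsilon$). Let $H_v(t_v(0))=F$ and $\mu_v(0)=\mu_v(1)=\vartheta$. In round $r=1,2,\dots$, put $L=H_v(t_v(r-1))+\tau_1/\mu_v(r-1)$. Node $v$ sends a first pulse at time $p_v(r)$ with $H_v(p_v(r))=L$ and a second pulse at local time $L+(\tau_2+\tau_3)/\mu_v(r)$. For each node $w$, $\tau_{wv}$ is the local time at which the first pulse from $w$ is received during the local time interval $[H_v(t_v(r-1)),\,L+\tau_2/\mu_v(r)]$,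 and $\tau'_{wv}$ the one for $(L+\tau_2/\mu_v(r),\,L+(\tau_2+\tau_3+\tau_4)/\mu_v(r)]$; the value is $\infty$ if there is none. For a multiset $S$ of $n$ values write $\operatorname{mid}(S)=(S^{f+1}+S^{n-f})/2$, where $S^k$ is the $k$-th smallest element. Then $$\Delta_v(r)=\operatorname{mid}\Big\{\tfrac{2(\tau_{wv}-\tau_{vv})}{\vartheta+1}\Big\}_w,\qquad \xi_v(r)=\operatorname{mid}\Big\{1-\tfrac{\mu_v(r)(\tau'_{wv}-\tau_{wv})}{\tau_2+\tau_3}\Big\}_w,\qquad \hat\mu_v(r+1)=\mu_v(r)+\tfrac{2\xi_v(r)}{\vartheta+1}.$$ The multiplier $\mu_v(r+1)$ is $\hat\mu_v(r+1)+\varepsilon$ if $\hat\mu_v(r+1)\le\vartheta$ and $\hat\mu_v(r+1)-\varepsilon$ otherwise, in both cases rounded to the nearest point of $[1,\vartheta^2]$. Round $r$ ends at time $t_v(r)$ with $H_v(t_v(r))=L+(T-\tau_1+\Delta_v(r))/\mu_v(r)$. The *steady state error* is $E=\limsup_{r\to\infty}e(r)$, where $e(r)$ is the supremum of $\max_{v,w\in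 C}|p_v(r)-p_w(r)|$ over all executions. **Constraints.** Put $$\bar\vartheta=\vartheta^3,\quad \alpha=\frac{4\bar\vartheta^2+5\bar\vartheta-7}{2(\bar\vartheta+1)},\quad \bar\beta=\frac{2\bar\vartheta^2+5\bar\vartheta-5}{2(\bar\vartheta+1)},\quad \bar\alpha=\bar\beta+(4\bar\vartheta+3)(\bar\vartheta-1),$$ $$e_1=\max\Big\{F+\big(1-\tfrac1{\bar\vartheta}\big)\tau_1,\ \frac{(1-1/\bar\vartheta)T+(3\bar\vartheta-1)U}{1-\bar\beta}\Big\}.$$ The constraints (*) are $\tau_1\ge\bar\vartheta e_1$, $\tau_2\ge\bar\vartheta(e_1+d)$, $\tau_3\ge\bar\vartheta\big(e_1+(1-\tfrac1{\bar\vartheta})(\tau_1+\tau_2)\big)$, $\tau_4\ge\bar\vartheta\big(e_1+d+(1-\tfrac1{\bar\vartheta})(\tau_2+\tau_3)\big)$, $T\ge\tau_1+\tau_2+\tau_3+\tau_4+\bar\vartheta(e_1+U)$ and $$\varepsilon\ \ge\ (\vartheta-1)(\vartheta^3-1)+2\vartheta^3\Big(1-\frac1{\vartheta^3}\Big)^2+\frac{2\vartheta^3U}{\tau_2+\tau_3}+2(\vartheta^3+1)\nu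 T .$$ **Statement.** (1) For every $\eta>0$ there is $\kappa>0$, depending only on $\eta$, such that the following holds for every system as above and all parameters. If (*) holds, $\bar\alpha<1$, $|\alpha-\tfrac12|\le\kappa$, $\varepsilon$ is the minimal value satisfying (*) (the other parameters being fixed), $|T-\tau_3|\le\kappa T$, $\tau_2\le\kappa\tau_3$ and $\max\{(\bar\vartheta-1)^2T,\ \nu T^2\}\le\kappa U$, then the steady state error satisfies $E\le(28+\eta)\,U$. (2) The assumption $T\approx\tau_3\gg\tau_2$ is feasible whenever $T\gg\bar\vartheta(e_1+d)$: for every $\kappa>0$ there is $\kappa'>0$, depending only on $\kappa$, such that for all $\vartheta>1$, $\nu>0$, $0\le U\le d$, $F>0$, $T>0$ with $\bar\alpha<1$, $\tau_1=\bar\vartheta e_1$ and $\bar\vartheta(e_1+d)\le\kappa'T$ there are $\tau_2,\tau_3,\tau_4,\varepsilon$ that satisfy (*) with $\varepsilon$ minimal, $|T-\tau_3|\le\kappa T$ and $\tau_2\le\kappa\tau_3$. -/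

import Mathlib

/-!
A fully connected system of `n` nodes, at most `f = ⌊(n-1)/3⌋` of them Byzantine, runs the
phase and frequency synchronization algorithm.
-/

/-- The parameters of the system and of the algorithm. -/
structure SyncParams where
  /-- number of nodes -/
  n : ℕ
  /-- width of the initial local time window -/
  F : ℝ
  /-- maximum message delay -/
  d : ℝ
  /-- delay uncertainty -/
  U : ℝ
  /-- maximum hardware clock rate (the minimum rate is `1`) -/
  ϑ : ℝ
  /-- Lipschitz constant of the hardware clock rates -/
  ν : ℝ
  τ₁ : ℝ
  τ₂ : ℝ
  τ₃ : ℝ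
  τ₄ : ℝ
  /-- nominal round length -/
  T : ℝ
  /-- amount by which rate multipliers are pulled back towards the nominal one -/
  ε : ℝ

namespace SyncParams

/-- The number of tolerated faults. -/
def f (P : SyncParams) : ℕ := (P.n - 1) / 3

/-- `ϑ̄ = ϑ³`. -/
noncomputable def ϑbar (P : SyncParams) : ℝ := P.ϑ ^ 3

noncomputable def α (P : SyncParams) : ℝ :=
  (4 * P.ϑbar ^ 2 + 5 * P.ϑbar - 7) / (2 * (P.ϑbar + 1))

noncomputable def βbar (P : SyncParams) : ℝ :=
  (2 * P.ϑbar ^ 2 + 5 * P.ϑbar - 5) / (2 * (P.ϑbar + 1))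

noncomputable def αbar (P : SyncParams) : ℝ :=
  P.βbar + (4 * P.ϑbar + 3) * (P.ϑbar - 1)

/-- `e(1)`, the bound on the initial synchronization error. -/
noncomputable def e₁ (P : SyncParams) : ℝ :=
  max (P.F + (1 - 1 / P.ϑbar) * P.τ₁)
    (((1 - 1 / P.ϑbar) * P.T + (3 * P.ϑbar - 1) * P.U) / (1 - P.βbar))

/-- The timing constraints on the parameters of the algorithm. -/
structure FreqConstraints (P : SyncParams) : Prop where
  tau_one : P.ϑbar * P.e₁ ≤ P.τ₁
  tau_two : P.ϑbar * (P.e₁ + P.d) ≤ P.τ₂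
  tau_three : P.ϑbar * (P.e₁ + (1 - 1 / P.ϑbar) * (P.τ₁ + P.τ₂)) ≤ P.τ₃
  tau_four : P.ϑbar * (P.e₁ + P.d + (1 - 1 / P.ϑbar) * (P.τ₂ + P.τ₃)) ≤ P.τ₄
  round_length : P.τ₁ + P.τ₂ + P.τ₃ + P.τ₄ + P.ϑbar * (P.e₁ + P.U) ≤ P.T
  pull_back :
    (P.ϑ - 1) * (P.ϑ ^ 3 - 1) + 2 * P.ϑ ^ 3 * (1 - 1 / P.ϑ ^ 3) ^ 2
      + 2 * P.ϑ ^ 3 * P.U / (P.τ₂ + P.τ₃) + 2 * (P.ϑ ^ 3 + 1) * P.ν * P.T ≤ P.ε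

/-- `ε` is the smallest value for which the constraints hold, all other parameters being fixed. -/
def MinimalPullBack (P : SyncParams) : Prop :=
  IsLeast {x : ℝ | FreqConstraints { P with ε := x }} P.ε

/-- The same system with other choices of `τ₂`, `τ₃`, `τ₄` and `ε`. -/
def withChoice (P : SyncParams) (τ₂ τ₃ τ₄ ε : ℝ) : SyncParams :=
  { P with τ₂ := τ₂, τ₃ := τ₃, τ₄ := τ₄, ε := ε }

end SyncParams

/-- The `k`-th smallest entry (`1 ≤ k ≤ n`, with multiplicity) of a tuple. -/
noncomputable def kthSmallest {n : ℕ} (g : Fin n → EReal) (k : ℕ) : EReal :=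
  if h : k - 1 < n then (g ∘ Tuple.sort g) ⟨k - 1, h⟩ else 0

/-- The midpoint of the `(f+1)`-th and the `(n-f)`-th smallest entry.  Both are finite whenever at
most `f` entries are infinite; the value of `toReal` at `±∞` is irrelevant otherwise. -/
noncomputable def agreementMidpoint {n : ℕ} (f : ℕ) (g : Fin n → EReal) : ℝ :=
  ((kthSmallest g (f + 1)).toReal + (kthSmallest g (n - f)).toReal) / 2

/-- The data of a run.  Rounds, pulses and multipliers are indexed as in `r = 1, 2, …`, where
`t v r` is the (Newtonian) time at which node `v` starts round `r + 1`. -/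
structure SyncRun (P : SyncParams) where
  /-- the set of correct nodes -/
  C : Finset (Fin P.n)
  /-- hardware clocks -/
  H : Fin P.n → ℝ → ℝ
  /-- hardware clock rates -/
  h : Fin P.n → ℝ → ℝ
  /-- round start times -/
  t : Fin P.n → ℕ → ℝ
  /-- times of the first (phase) pulse of each round -/
  p : Fin P.n → ℕ → ℝ
  /-- times of the second (frequency) pulse of each round -/
  q : Fin P.n → ℕ → ℝ
  /-- rate multipliers -/
  μ : Fin P.n → ℕ → ℝ
  /-- `a w v r`: time at which `v` receives the first pulse that `w` sends in round `r` -/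
  a : Fin P.n → Fin P.n → ℕ → ℝ
  /-- `b w v r`: time at which `v` receives the second pulse that `w` sends in round `r` -/
  b : Fin P.n → Fin P.n → ℕ → ℝ
  /-- `recv w v`: all times at which `v` receives a pulse from `w` -/
  recv : Fin P.n → Fin P.n → Set ℝ

namespace SyncRun

variable {P : SyncParams} (X : SyncRun P)

/-- Local time at which `v` sends its first pulse in round `r + 1`. -/
noncomputable def localPulse (v : Fin P.n) (r : ℕ) : ℝ :=
  X.H v (X.t v r) + P.τ₁ / X.μ v r

/-- Local time at which `v` stops listening for first pulses of round `r + 1`. -/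
noncomputable def localPhaseEnd (v : Fin P.n) (r : ℕ) : ℝ :=
  X.localPulse v r + P.τ₂ / X.μ v (r + 1)

/-- Local time at which `v` sends its second pulse in round `r + 1`. -/
noncomputable def localFreqPulse (v : Fin P.n) (r : ℕ) : ℝ :=
  X.localPulse v r + (P.τ₂ + P.τ₃) / X.μ v (r + 1)

/-- Local time at which `v` stops listening for second pulses of round `r + 1`. -/
noncomputable def localFreqEnd (v : Fin P.n) (r : ℕ) : ℝ :=
  X.localPulse v r + (P.τ₂ + P.τ₃ + P.τ₄) / X.μ v (r + 1)

/-- Pulses from `w` that `v` receives while listening for first pulses of round `r + 1`. -/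
def phaseHeard (w v : Fin P.n) (r : ℕ) : Set ℝ :=
  {s ∈ X.recv w v | 0 ≤ s ∧ X.H v s ∈ Set.Icc (X.H v (X.t v r)) (X.localPhaseEnd v r)}

/-- Pulses from `w` that `v` receives while listening for second pulses of round `r + 1`. -/
def freqHeard (w v : Fin P.n) (r : ℕ) : Set ℝ :=
  {s ∈ X.recv w v | 0 ≤ s ∧ X.H v s ∈ Set.Ioc (X.localPhaseEnd v r) (X.localFreqEnd v r)}

/-- The local time `H_v(t_wv)` of the first pulse heard in the phase correction step. -/
noncomputable def phaseStamp (w v : Fin P.n) (r : ℕ) : ℝ :=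
  X.H v (sInf (X.phaseHeard w v r))

/-- The local time `H_v(t'_wv)` of the first pulse heard in the frequency correction step. -/
noncomputable def freqStamp (w v : Fin P.n) (r : ℕ) : ℝ :=
  X.H v (sInf (X.freqHeard w v r))

open Classical in
/-- The estimate of the phase offset of `w` at node `v` in round `r + 1`; it is `∞` if no pulse
of `w` is heard. -/
noncomputable def phaseEntry (v : Fin P.n) (r : ℕ) (w : Fin P.n) : EReal :=
  if (X.phaseHeard w v r).Nonempty then
    ((2 * (X.phaseStamp w v r - X.phaseStamp v v r) / (P.ϑ + 1) : ℝ) : EReal)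
  else ⊤

/-- The phase correction `Δ_v` of round `r + 1`. -/
noncomputable def Δ (v : Fin P.n) (r : ℕ) : ℝ :=
  agreementMidpoint P.f (X.phaseEntry v r)

open Classical in
/-- The estimate of the rate offset of `w` at node `v` in round `r + 1`; a missing second
(respectively first) pulse counts as received at local time `∞`. -/
noncomputable def freqEntry (v : Fin P.n) (r : ℕ) (w : Fin P.n) : EReal :=
  if (X.freqHeard w v r).Nonempty then
    if (X.phaseHeard w v r).Nonempty then
      ((1 - X.μ v (r + 1) * (X.freqStamp w v r - X.phaseStamp w v r) / (P.τ₂ + P.τ₃) : ℝ) : EReal)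
    else ⊤
  else ⊥

/-- The frequency correction `ξ_v` of round `r + 1`. -/
noncomputable def ξ (v : Fin P.n) (r : ℕ) : ℝ :=
  agreementMidpoint P.f (X.freqEntry v r)

/-- The multiplier computed in round `r + 1` before it is pulled back. -/
noncomputable def μhat (v : Fin P.n) (r : ℕ) : ℝ :=
  X.μ v (r + 1) + 2 * X.ξ v r / (P.ϑ + 1)

/-- `X` is an execution of the phase and frequency synchronization algorithm. -/
structure IsExecution : Prop where
  /-- at most `f` nodes are faulty -/
  faults : P.n - X.C.card ≤ P.f
  clock_drift : ∀ v ∈ X.C, ∀ s s' : ℝ, 0 ≤ s → s < s' →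
    s' - s ≤ X.H v s' - X.H v s ∧ X.H v s' - X.H v s ≤ P.ϑ * (s' - s)
  clock_deriv : ∀ v ∈ X.C, ∀ s : ℝ, 0 ≤ s → HasDerivWithinAt (X.H v) (X.h v s) (Set.Ici 0) s
  rate_mem : ∀ v ∈ X.C, ∀ s : ℝ, 0 ≤ s → X.h v s ∈ Set.Icc 1 P.ϑ
  rate_lipschitz : ∀ v ∈ X.C, ∀ s s' : ℝ, 0 ≤ s → 0 ≤ s' →
    |X.h v s' - X.h v s| ≤ P.ν * |s' - s|
  clock_init : ∀ v ∈ X.C, X.H v 0 ∈ Set.Ico 0 P.F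
  /-- a pulse sent by a correct node reaches every correct node with a delay in `[d - U, d]` -/
  phase_delay : ∀ w ∈ X.C, ∀ v ∈ X.C, ∀ r : ℕ,
    X.a w v (r + 1) ∈ Set.Icc (X.p w (r + 1) + P.d - P.U) (X.p w (r + 1) + P.d)
  freq_delay : ∀ w ∈ X.C, ∀ v ∈ X.C, ∀ r : ℕ,
    X.b w v (r + 1) ∈ Set.Icc (X.q w (r + 1) + P.d - P.U) (X.q w (r + 1) + P.d)
  /-- correct nodes receive from correct nodes exactly the pulses that these send -/
  recv_correct : ∀ w ∈ X.C, ∀ v ∈ X.C,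
    X.recv w v = {s | ∃ r : ℕ, s = X.a w v (r + 1) ∨ s = X.b w v (r + 1)}
  /-- faulty nodes send arbitrary pulses, finitely many in bounded time -/
  recv_faulty : ∀ w ∉ X.C, ∀ v ∈ X.C, ∀ s : ℝ, (X.recv w v ∩ Set.Iic s).Finite
  t_nonneg : ∀ v ∈ X.C, ∀ r : ℕ, 0 ≤ X.t v r
  p_nonneg : ∀ v ∈ X.C, ∀ r : ℕ, 0 ≤ X.p v (r + 1)
  q_nonneg : ∀ v ∈ X.C, ∀ r : ℕ, 0 ≤ X.q v (r + 1)
  t_zero : ∀ v ∈ X.C, X.H v (X.t v 0) = P.F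
  μ_zero : ∀ v ∈ X.C, X.μ v 0 = P.ϑ
  μ_one : ∀ v ∈ X.C, X.μ v 1 = P.ϑ
  pulse : ∀ v ∈ X.C, ∀ r : ℕ, X.H v (X.p v (r + 1)) = X.localPulse v r
  freq_pulse : ∀ v ∈ X.C, ∀ r : ℕ, X.H v (X.q v (r + 1)) = X.localFreqPulse v r
  /-- the multiplier is moved by `ε` towards `ϑ` and kept in the range `[1, ϑ²]` -/
  μ_step : ∀ v ∈ X.C, ∀ r : ℕ,
    X.μ v (r + 2) =
      if X.μhat v r ≤ P.ϑ then max 1 (min (P.ϑ ^ 2) (X.μhat v r + P.ε))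
      else max 1 (min (P.ϑ ^ 2) (X.μhat v r - P.ε))
  /-- from the first pulse of round `r + 1` to that of round `r + 2`, node `v` counts
  `T + Δ_v` units of its local time scaled by the multiplier of round `r + 1` -/
  t_step : ∀ v ∈ X.C, ∀ r : ℕ,
    X.H v (X.t v (r + 1)) = X.localPulse v r + (P.T - P.τ₁ + X.Δ v r) / X.μ v (r + 1)

/-- `‖p(r)‖`: the largest difference between the times of the `r`-th (first) pulses of correct
nodes. -/
noncomputable def skew (r : ℕ) : EReal :=
  ⨆ v ∈ X.C, ⨆ w ∈ X.C, ((X.p v r - X.p w r : ℝ) : EReal)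

end SyncRun

/-- The steady state error `E = lim_{r' → ∞} sup_{r ≥ r'} e(r)`, where `e(r)` is the worst-case
synchronization error of the `r`-th pulse over all executions. -/
noncomputable def steadyStateError (P : SyncParams) : EReal :=
  Filter.limsup (fun r : ℕ => ⨆ X : {X : SyncRun P // X.IsExecution}, X.1.skew r) Filter.atTop

/-! Phase and rate corrections are both instances of approximate agreement. As `3f + 1 ≤ n`, some
correct value has at least `f + 1` correct values on either side. Up to estimation errors this pivot
lies between the two order statistics that every node averages, whatever the faulty nodes report.
All results therefore fall into a common interval of half the former length, widened by the error at
both ends (`exists_agreementMidpoint_bounds`).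

Phases: if the pulses of a round lie within `e₁`, the timing constraints make the earliest pulse
heard in each window the intended one. Crude rate bounds then show that `e₁` reproduces itself, so
every round is synchronized (`synced`). A sharper recursion is, to leading order, `e ↦ e/2 + 2U + T
s`, where `s` is the spread of the scaled rates `μ h` (`skew_succ_le_of_rate`).

Rates: put `γ = U / T`. Near ideal parameters rates are estimated with error about `γ` and `ϑ ε` is
about `2γ`, so `s ↦ s/2 + 2(γ + 2γ)` with limit `12γ`. The pull-back confines all rates to `[ϑ - 3γ,
ϑ² + 3γ]`, so that clamping does no harm (`rate_succ`). Thus `T s` tends to `12U`, the skew obeys `e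
↦ e/2 + 14U`, and the limit is `28U`. The bounding sequences do not depend on the execution
(`eventually_skew_le`).

Feasibility: `τ₂` and `τ₄` are taken minimal and `τ₃` gets the rest of the round. The definition of
`e₁` yields `(ϑ̄ - 1) T ≤ ϑ̄ e₁`, so all other phases together cost `O(ϑ̄ (e₁ + d))`
(`exists_feasible_choice`). -/

/-! ### Order statistics and one step of approximate agreement. -/

/-- Otherwise the sorted positions of `A` would all lie before position `k - 1`, where there is room
for only `k - 1` of them. -/
theorem kthSmallest_le {n k : ℕ} {g : Fin n → EReal} {A : Finset (Fin n)} {x : EReal}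
    (hk : 1 ≤ k) (hA : k ≤ A.card) (h : ∀ i ∈ A, g i ≤ x) : kthSmallest g k ≤ x := by
  have hn : A.card ≤ n := by simpa using A.card_le_univ
  have hkn : k - 1 < n := by omega
  rw [kthSmallest, dif_pos hkn]
  by_contra! hlt
  have hsub : A.image (Tuple.sort g).symm ⊆ Finset.Iio (⟨k - 1, hkn⟩ : Fin n) := by
    intro j hj
    obtain ⟨i, hi, rfl⟩ := Finset.mem_image.mp hj
    rw [Finset.mem_Iio]
    by_contra! hle
    have h1 := Tuple.monotone_sort g hle
    simp only [Function.comp_apply, Equiv.apply_symm_apply] at h1 hlt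
    exact absurd (h i hi) (not_le.mpr (hlt.trans_le h1))
  have hc := Finset.card_le_card hsub
  rw [Finset.card_image_of_injective _ (Tuple.sort g).symm.injective, Fin.card_Iio] at hc
  simp only at hc
  omega

theorem le_kthSmallest {n k : ℕ} {g : Fin n → EReal} {A : Finset (Fin n)} {x : EReal}
    (hk : 1 ≤ k) (hkn : k ≤ n) (hA : n - k + 1 ≤ A.card) (h : ∀ i ∈ A, x ≤ g i) :
    x ≤ kthSmallest g k := by
  have hkn' : k - 1 < n := by omega
  rw [kthSmallest, dif_pos hkn']
  by_contra! hlt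
  have hsub : A.image (Tuple.sort g).symm ⊆ Finset.Ioi (⟨k - 1, hkn'⟩ : Fin n) := by
    intro j hj
    obtain ⟨i, hi, rfl⟩ := Finset.mem_image.mp hj
    rw [Finset.mem_Ioi]
    by_contra! hle
    have h1 := Tuple.monotone_sort g hle
    simp only [Function.comp_apply, Equiv.apply_symm_apply] at h1 hlt
    exact absurd (h i hi) (not_le.mpr (h1.trans_lt hlt))
  have hc := Finset.card_le_card hsub
  rw [Finset.card_image_of_injective _ (Tuple.sort g).symm.injective, Fin.card_Ioi] at hc
  simp only at hc
  omega

/-- The bound has to be nonpositive because `toReal ⊤` and the out-of-range default are both `0`.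
This serves rounds in which nothing is known about how many pulses are missing. -/
theorem le_toReal_kthSmallest {n k : ℕ} {g : Fin n → EReal} {x : ℝ} (hx : x ≤ 0)
    (h : ∀ i, g i = ⊤ ∨ ∃ y : ℝ, g i = y ∧ x ≤ y) : x ≤ (kthSmallest g k).toReal := by
  rw [kthSmallest]
  split_ifs with hk
  · rcases h (Tuple.sort g ⟨k - 1, hk⟩) with h1 | ⟨y, h1, h2⟩
    · simp [Function.comp_apply, h1, hx]
    · simp [Function.comp_apply, h1, h2]
  · simp [hx]

theorem le_agreementMidpoint {n f : ℕ} {g : Fin n → EReal} {x : ℝ} (hx : x ≤ 0)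
    (h : ∀ i, g i = ⊤ ∨ ∃ y : ℝ, g i = y ∧ x ≤ y) : x ≤ agreementMidpoint f g := by
  have h1 := le_toReal_kthSmallest (k := f + 1) hx h
  have h2 := le_toReal_kthSmallest (k := n - f) hx h
  rw [agreementMidpoint]
  linarith

/-- Among at least `2f+1` values there is one with at least `f+1` values on either side. -/
theorem exists_pivot {ι : Type*} (C : Finset ι) (f : ℕ) (hC : 2 * f + 1 ≤ C.card) (y : ι → ℝ) :
    ∃ i ∈ C, f + 1 ≤ (C.filter fun j => y j ≤ y i).card ∧
      f + 1 ≤ (C.filter fun j => y i ≤ y j).card := by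
  -- The pivot is the least value with `f + 1` values at or below it. Were `f + 1` values strictly
  -- smaller, the largest of those would have the same property.
  let B := C.filter fun i => f + 1 ≤ (C.filter fun j => y j ≤ y i).card
  have hB : B.Nonempty := by
    have hne : C.Nonempty := Finset.card_pos.mp (by omega)
    obtain ⟨i, hi, hmax⟩ := C.exists_max_image y hne
    refine ⟨i, Finset.mem_filter.mpr ⟨hi, ?_⟩⟩
    rw [Finset.filter_true_of_mem hmax]
    omega
  obtain ⟨i, hi, hmin⟩ := B.exists_min_image y hB
  obtain ⟨hiC, hcard⟩ := Finset.mem_filter.mp hi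
  refine ⟨i, hiC, hcard, ?_⟩
  have hlow : (C.filter fun j => ¬ y i ≤ y j).card ≤ f := by
    by_contra hlt
    rw [not_le] at hlt
    obtain ⟨k, hk, hkmax⟩ := (C.filter fun j => ¬ y i ≤ y j).exists_max_image y
      (Finset.card_pos.mp (by omega))
    obtain ⟨hkC, hki⟩ := Finset.mem_filter.mp hk
    have hkB : k ∈ B := by
      refine Finset.mem_filter.mpr ⟨hkC, ?_⟩
      refine le_trans hlt (Finset.card_le_card fun j hj => ?_)
      exact Finset.mem_filter.mpr ⟨(Finset.mem_filter.mp hj).1, hkmax j hj⟩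
    exact hki (hmin k hkB)
  have hsum := Finset.card_filter_add_card_filter_not (s := C) (fun j => y i ≤ y j)
  omega

/-- One step of approximate agreement: nodes with different estimates of the values `y` all arrive
in a common interval of half the original length, up to the estimation error. -/
theorem exists_agreementMidpoint_bounds {n f : ℕ} (hf : 3 * f + 1 ≤ n) (C : Finset (Fin n))
    (hC : n ≤ C.card + f) (y : Fin n → ℝ) :
    ∃ i ∈ C, ∀ (g : Fin n → EReal) (z δ lo hi : ℝ),
      (∀ w ∈ C, lo ≤ y w ∧ y w ≤ hi) →
      (∀ w ∈ C, ∃ x : ℝ, g w = x ∧ |x - (y w - z)| ≤ δ) →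
      (lo + y i) / 2 - δ ≤ agreementMidpoint f g + z ∧
        agreementMidpoint f g + z ≤ (y i + hi) / 2 + δ := by
  obtain ⟨i, hiC, h1, h2⟩ := exists_pivot C f (by omega) y
  -- The pivot depends on `y` alone, so all observers share it. Here `z` is the observer's own
  -- value, to which its entries `g` are relative.
  refine ⟨i, hiC, fun g z δ lo hi hy hg => ?_⟩
  have upper : ∀ (A : Finset (Fin n)) (b : ℝ) (k : ℕ), A ⊆ C → (∀ w ∈ A, y w ≤ b) → 1 ≤ k →
      k ≤ A.card → kthSmallest g k ≤ ((b - z + δ : ℝ) : EReal) := by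
    intro A b k hA hb hk hkA
    refine kthSmallest_le hk hkA fun w hw => ?_
    obtain ⟨x, hx, hxy⟩ := hg w (hA hw)
    rw [hx, EReal.coe_le_coe_iff]
    have := (abs_le.mp hxy).2
    linarith [hb w hw]
  have lower : ∀ (A : Finset (Fin n)) (b : ℝ) (k : ℕ), A ⊆ C → (∀ w ∈ A, b ≤ y w) → 1 ≤ k →
      k ≤ n → n - k + 1 ≤ A.card → ((b - z - δ : ℝ) : EReal) ≤ kthSmallest g k := by
    intro A b k hA hb hk hkn hkA
    refine le_kthSmallest hk hkn hkA fun w hw => ?_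
    obtain ⟨x, hx, hxy⟩ := hg w (hA hw)
    rw [hx, EReal.coe_le_coe_iff]
    have := (abs_le.mp hxy).1
    linarith [hb w hw]
  have a1 := upper (C.filter fun j => y j ≤ y i) (y i) (f + 1) (Finset.filter_subset _ _)
    (fun w hw => (Finset.mem_filter.mp hw).2) (by omega) h1
  have a2 := lower C lo (f + 1) subset_rfl (fun w hw => (hy w hw).1) (by omega) (by omega)
    (by omega)
  have a3 := upper C hi (n - f) subset_rfl (fun w hw => (hy w hw).2) (by omega) (by omega)
  have a4 := lower (C.filter fun j => y i ≤ y j) (y i) (n - f) (Finset.filter_subset _ _)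
    (fun w hw => (Finset.mem_filter.mp hw).2) (by omega) (by omega) (by omega)
  -- Two real bounds also exclude `±∞`, which makes `toReal` harmless.
  have real : ∀ (x : EReal) (l u : ℝ), (l : EReal) ≤ x → x ≤ (u : EReal) →
      l ≤ x.toReal ∧ x.toReal ≤ u := by
    intro x l u hl hu
    induction x with
    | bot => simp at hl
    | top => simp at hu
    | coe x => exact ⟨EReal.coe_le_coe_iff.mp hl, EReal.coe_le_coe_iff.mp hu⟩
  obtain ⟨b1, b2⟩ := real _ _ _ a2 a1
  obtain ⟨b3, b4⟩ := real _ _ _ a4 a3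
  rw [agreementMidpoint]
  constructor <;> linarith

/-! ### Consequences of the parameter constraints. -/

/-- The standing assumptions on the parameters. -/
structure SyncParams.Admissible (P : SyncParams) : Prop where
  one_lt : 1 < P.ϑ
  nu_pos : 0 < P.ν
  U_nonneg : 0 ≤ P.U
  U_le : P.U ≤ P.d
  constraints : P.FreqConstraints
  alpha_lt : P.αbar < 1
  F_pos : 0 < P.F

namespace SyncParams

theorem one_lt_ϑbar {P : SyncParams} (h : 1 < P.ϑ) : 1 < P.ϑbar :=
  one_lt_pow₀ h (by norm_num)

theorem sub_one_le_ϑbar {P : SyncParams} (h : 1 < P.ϑ) : 3 * (P.ϑ - 1) ≤ P.ϑbar - 1 := by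
  rw [ϑbar]
  nlinarith [mul_pos (sub_pos.mpr h) (sub_pos.mpr h), pow_pos (sub_pos.mpr h) 3]

theorem βbar_eq {P : SyncParams} (h : 1 < P.ϑ) :
    P.βbar = 1 / 2 + (P.ϑbar - 1) * (P.ϑbar + 3) / (P.ϑbar + 1) := by
  have := one_lt_ϑbar h
  rw [βbar]
  field_simp
  ring

/-- Makes room below `β̄` for the contraction factor of one round; together with `β̄ < 1` it gives
`ϑ̄ < 3/2`. -/
theorem βbar_ge {P : SyncParams} (h : 1 < P.ϑ) : 1 / 2 + (P.ϑbar - 1) ≤ P.βbar := by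
  have := one_lt_ϑbar h
  rw [βbar_eq h, add_le_add_iff_left, le_div_iff₀ (by linarith)]
  exact mul_le_mul_of_nonneg_left (by linarith) (by linarith)

theorem βbar_lt {P : SyncParams} (h : 1 < P.ϑ) (hα : P.αbar < 1) : P.βbar < 1 := by
  have := one_lt_ϑbar h
  have h2 : 0 < (4 * P.ϑbar + 3) * (P.ϑbar - 1) := mul_pos (by linarith) (by linarith)
  rw [αbar] at hα
  linarith

theorem initial_le (P : SyncParams) : P.F + (1 - 1 / P.ϑbar) * P.τ₁ ≤ P.e₁ :=
  le_max_left _ _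

theorem three_mul_f_lt {P : SyncParams} (h : 0 < P.n) : 3 * P.f + 1 ≤ P.n := by
  rw [f]
  omega

namespace Admissible

variable {P : SyncParams}

theorem ϑbar_gt (hP : P.Admissible) : 1 < P.ϑbar := one_lt_ϑbar hP.one_lt

theorem ϑ_lt_ϑbar (hP : P.Admissible) : P.ϑ < P.ϑbar := by
  linarith [sub_one_le_ϑbar hP.one_lt, hP.one_lt]

theorem ϑbar_lt (hP : P.Admissible) : P.ϑbar < 3 / 2 := by
  linarith [βbar_ge hP.one_lt, βbar_lt hP.one_lt hP.alpha_lt]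

theorem mul_one_sub (hP : P.Admissible)
    (x : ℝ) : P.ϑbar * ((1 - 1 / P.ϑbar) * x) = (P.ϑbar - 1) * x := by
  have := hP.ϑbar_gt
  field_simp

/-- The second branch of `e₁` is the fixed point of the crude error recursion, so an error of `e₁`
reproduces itself. -/
theorem fixpoint (hP : P.Admissible) :
    P.βbar * P.e₁ + (1 - 1 / P.ϑbar) * P.T + (3 * P.ϑbar - 1) * P.U ≤ P.e₁ := by
  have h : ((1 - 1 / P.ϑbar) * P.T + (3 * P.ϑbar - 1) * P.U) / (1 - P.βbar) ≤ P.e₁ :=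
    le_max_right _ _
  rw [div_le_iff₀ (by linarith [βbar_lt hP.one_lt hP.alpha_lt])] at h
  linarith

/-- The constraint on `τ₁` is self-referential, as `e₁` contains `(1 - 1/ϑ̄) τ₁`. It reads `(2 - ϑ̄)
τ₁ ≥ ϑ̄ F`, and `ϑ̄ < 3/2`. -/
theorem τ₁_pos (hP : P.Admissible) : 0 < P.τ₁ := by
  have h1 := hP.constraints.tau_one
  have h2 := mul_le_mul_of_nonneg_left P.initial_le (by linarith [hP.ϑbar_gt] : 0 ≤ P.ϑbar)
  rw [mul_add, hP.mul_one_sub] at h2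
  have h3 : 0 < P.ϑbar * P.F := mul_pos (by linarith [hP.ϑbar_gt]) hP.F_pos
  have h4 : 0 < (2 - P.ϑbar) * P.τ₁ := by linarith
  exact pos_of_mul_pos_right h4 (by linarith [hP.ϑbar_lt])

theorem e₁_pos (hP : P.Admissible) : 0 < P.e₁ := by
  have h1 : 0 ≤ (1 - 1 / P.ϑbar) * P.τ₁ := by
    refine mul_nonneg ?_ hP.τ₁_pos.le
    rw [sub_nonneg, div_le_one (by linarith [hP.ϑbar_gt])]
    exact hP.ϑbar_gt.le
  linarith [P.initial_le, hP.F_pos]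

theorem d_nonneg (hP : P.Admissible) : 0 ≤ P.d := hP.U_nonneg.trans hP.U_le

theorem le_ϑbar_mul (hP : P.Admissible) {x : ℝ} (hx : 0 ≤ x) : x ≤ P.ϑbar * x :=
  le_mul_of_one_le_left hx hP.ϑbar_gt.le

theorem τ₂_ge (hP : P.Admissible) : P.e₁ + P.d ≤ P.τ₂ :=
  (hP.le_ϑbar_mul (by linarith [hP.e₁_pos, hP.d_nonneg])).trans hP.constraints.tau_two

theorem τ₂_pos (hP : P.Admissible) : 0 < P.τ₂ := by linarith [hP.τ₂_ge, hP.e₁_pos, hP.d_nonneg]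

theorem τ₃_ge (hP : P.Admissible) : P.ϑbar * P.e₁ + (P.ϑbar - 1) * (P.τ₁ + P.τ₂) ≤ P.τ₃ := by
  have h := hP.constraints.tau_three
  rwa [mul_add, hP.mul_one_sub] at h

theorem τ₃_pos (hP : P.Admissible) : 0 < P.τ₃ := by
  have h1 : 0 < P.ϑbar * P.e₁ := mul_pos (by linarith [hP.ϑbar_gt]) hP.e₁_pos
  have h2 : 0 ≤ (P.ϑbar - 1) * (P.τ₁ + P.τ₂) :=
    mul_nonneg (by linarith [hP.ϑbar_gt]) (by linarith [hP.τ₁_pos, hP.τ₂_pos])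
  linarith [hP.τ₃_ge]

theorem τ₄_ge (hP : P.Admissible) :
    P.ϑbar * (P.e₁ + P.d) + (P.ϑbar - 1) * (P.τ₂ + P.τ₃) ≤ P.τ₄ := by
  have h := hP.constraints.tau_four
  rwa [mul_add, hP.mul_one_sub] at h

theorem τ₄_ge' (hP : P.Admissible) : P.ϑbar * (P.e₁ + P.d) ≤ P.τ₄ := by
  have h2 : 0 ≤ (P.ϑbar - 1) * (P.τ₂ + P.τ₃) :=
    mul_nonneg (by linarith [hP.ϑbar_gt]) (by linarith [hP.τ₃_pos, hP.τ₂_pos])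
  linarith [hP.τ₄_ge]

theorem τ₄_pos (hP : P.Admissible) : 0 < P.τ₄ := by
  linarith [hP.τ₄_ge', hP.le_ϑbar_mul (x := P.e₁ + P.d) (by linarith [hP.e₁_pos, hP.d_nonneg]),
    hP.e₁_pos, hP.d_nonneg]

theorem T_ge (hP : P.Admissible) : P.τ₁ + P.τ₂ + P.τ₃ + P.τ₄ + P.ϑbar * (P.e₁ + P.U) ≤ P.T :=
  hP.constraints.round_length

theorem window_pos (hP : P.Admissible) : 0 < P.ϑbar * (P.e₁ + P.U) :=
  mul_pos (by linarith [hP.ϑbar_gt]) (by linarith [hP.e₁_pos, hP.U_nonneg])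

theorem T_pos (hP : P.Admissible) : 0 < P.T := by
  linarith [hP.T_ge, hP.τ₁_pos, hP.τ₂_pos, hP.τ₃_pos, hP.τ₄_pos, hP.window_pos]

end Admissible

end SyncParams

/-! ### Clocks, elapsed time and the spacing of pulses. -/

namespace SyncRun.IsExecution

variable {P : SyncParams} {X : SyncRun P} {v : Fin P.n}

theorem card_le (hX : X.IsExecution) : P.n ≤ X.C.card + P.f := by
  have := hX.faults
  omega

theorem F_pos (hX : X.IsExecution) (hv : v ∈ X.C) :
    0 < P.F := (hX.clock_init v hv).1.trans_lt (hX.clock_init v hv).2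

theorem μ_mem (hX : X.IsExecution) (hv : v ∈ X.C)
    (h : 1 < P.ϑ) (r : ℕ) : X.μ v r ∈ Set.Icc 1 (P.ϑ ^ 2) := by
  have h1 : P.ϑ ∈ Set.Icc 1 (P.ϑ ^ 2) := ⟨h.le, by nlinarith⟩
  have h2 : (1 : ℝ) ≤ P.ϑ ^ 2 := h1.1.trans h1.2
  match r with
  | 0 => rwa [hX.μ_zero v hv]
  | 1 => rwa [hX.μ_one v hv]
  | r + 2 =>
    rw [hX.μ_step v hv r]
    split_ifs <;> exact ⟨le_max_left _ _, max_le h2 (min_le_left _ _)⟩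

theorem H_lt (hX : X.IsExecution) (hv : v ∈ X.C)
    {s s' : ℝ} (hs : 0 ≤ s) (h : s < s') : X.H v s < X.H v s' := by
  linarith [(hX.clock_drift v hv s s' hs h).1]

theorem H_mono (hX : X.IsExecution) (hv : v ∈ X.C)
    {s s' : ℝ} (hs : 0 ≤ s) (h : s ≤ s') : X.H v s ≤ X.H v s' := by
  rcases h.eq_or_lt with rfl | h
  · rfl
  · exact (hX.H_lt hv hs h).le

theorem le_of_H_le (hX : X.IsExecution) (hv : v ∈ X.C)
    {s s' : ℝ} (hs' : 0 ≤ s') (h : X.H v s ≤ X.H v s') : s ≤ s' := by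
  by_contra! hlt
  exact absurd (hX.H_lt hv hs' hlt) (not_lt.mpr h)

theorem lt_of_H_lt (hX : X.IsExecution) (hv : v ∈ X.C)
    {s s' : ℝ} (hs' : 0 ≤ s') (h : X.H v s < X.H v s') : s < s' := by
  by_contra! hle
  exact absurd (hX.H_mono hv hs' hle) (not_le.mpr h)

theorem drift (hX : X.IsExecution) (hv : v ∈ X.C) {s s' : ℝ} (hs : 0 ≤ s) (h : s ≤ s') :
    s' - s ≤ X.H v s' - X.H v s ∧ X.H v s' - X.H v s ≤ P.ϑ * (s' - s) := by
  rcases h.eq_or_lt with rfl | h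
  · simp
  · exact hX.clock_drift v hv s s' hs h

/-- A clock scaled by `μ ∈ [1, ϑ²]` runs at a rate between `1` and `ϑ² · ϑ = ϑ̄`. -/
theorem elapsed (hX : X.IsExecution) (hv : v ∈ X.C)
    (hϑ : 1 < P.ϑ) {s s' x μ : ℝ} (hs : 0 ≤ s) (hs' : 0 ≤ s') (hμ : 1 ≤ μ)
    (hμ' : μ ≤ P.ϑ ^ 2) (hx : 0 ≤ x) (h : X.H v s' = X.H v s + x / μ) :
    s ≤ s' ∧ x ≤ P.ϑbar * (s' - s) ∧ s' - s ≤ x := by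
  have hμ0 : 0 < μ := by linarith
  have hle : s ≤ s' := hX.le_of_H_le hv hs' (by rw [h]; linarith [div_nonneg hx hμ0.le])
  obtain ⟨h1, h2⟩ := hX.drift hv hs hle
  have h3 : X.H v s' - X.H v s = x / μ := by linarith
  rw [h3] at h1 h2
  refine ⟨hle, ?_, h1.trans (div_le_self hx hμ)⟩
  rw [div_le_iff₀ hμ0] at h2
  refine h2.trans ?_
  rw [SyncParams.ϑbar, show P.ϑ ^ 3 * (s' - s) = P.ϑ * (s' - s) * P.ϑ ^ 2 by ring]
  exact mul_le_mul_of_nonneg_left hμ' (mul_nonneg (by linarith) (by linarith))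

theorem exists_rate (hX : X.IsExecution) (hv : v ∈ X.C) {s s' : ℝ} (hs : 0 ≤ s) (h : s < s') :
    ∃ c ∈ Set.Ioo s s', X.H v s' - X.H v s = X.h v c * (s' - s) := by
  have hd : ∀ x ∈ Set.Icc s s', HasDerivWithinAt (X.H v) (X.h v x) (Set.Ici 0) x :=
    fun x hx => hX.clock_deriv v hv x (hs.trans hx.1)
  obtain ⟨c, hc, hc'⟩ := exists_hasDerivAt_eq_slope (X.H v) (X.h v) h
    (fun x hx => (hd x hx).continuousWithinAt.mono fun y hy => hs.trans hy.1)
    (fun x hx => (hd x ⟨hx.1.le, hx.2.le⟩).hasDerivAt (Ici_mem_nhds (hs.trans_lt hx.1)))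
  refine ⟨c, hc, ?_⟩
  rw [hc', div_mul_cancel₀]
  exact (sub_pos.mpr h).ne'

/-- A positive amount `x` of local time scaled by `μ` takes real time `x / (μ * h v c)`. -/
theorem exists_elapsed (hX : X.IsExecution) (hv : v ∈ X.C)
    {s s' x μ : ℝ} (hs : 0 ≤ s) (hs' : 0 ≤ s') (hμ : 1 ≤ μ) (hx : 0 < x)
    (h : X.H v s' = X.H v s + x / μ) :
    ∃ c ∈ Set.Ioo s s', s' = s + x / (μ * X.h v c) := by
  have hμ0 : 0 < μ := by linarith
  have hlt : s < s' := by
    refine lt_of_le_of_ne (hX.le_of_H_le hv hs' (by rw [h]; linarith [div_pos hx hμ0])) ?_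
    rintro rfl
    linarith [div_pos hx hμ0]
  obtain ⟨c, hc, hc'⟩ := hX.exists_rate hv hs hlt
  refine ⟨c, hc, ?_⟩
  have h1 : 0 < X.h v c := by linarith [(hX.rate_mem v hv c (hs.trans hc.1.le)).1]
  have h3 : x / μ = X.h v c * (s' - s) := by linarith
  rw [div_eq_iff hμ0.ne'] at h3
  rw [h3]
  field_simp
  ring

theorem localPulse_succ (hX : X.IsExecution) (hv : v ∈ X.C) (r : ℕ) :
    X.localPulse v (r + 1) = X.localPulse v r + (P.T + X.Δ v r) / X.μ v (r + 1) := by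
  rw [localPulse, hX.t_step v hv r]
  ring

theorem pulse_succ (hX : X.IsExecution) (hv : v ∈ X.C) (r : ℕ) :
    X.H v (X.p v (r + 2)) = X.H v (X.p v (r + 1)) + (P.T + X.Δ v r) / X.μ v (r + 1) := by
  rw [hX.pulse v hv (r + 1), hX.pulse v hv r, hX.localPulse_succ hv]

theorem freq_pulse' (hX : X.IsExecution) (hv : v ∈ X.C) (r : ℕ) :
    X.H v (X.q v (r + 1)) = X.H v (X.p v (r + 1)) + (P.τ₂ + P.τ₃) / X.μ v (r + 1) := by
  rw [hX.freq_pulse v hv r, hX.pulse v hv r, localFreqPulse]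

theorem pulse' (hX : X.IsExecution) (hv : v ∈ X.C) (r : ℕ) :
    X.H v (X.p v (r + 1)) = X.H v (X.t v r) + P.τ₁ / X.μ v r :=
  hX.pulse v hv r

theorem phaseStamp_ge (hX : X.IsExecution) (hv : v ∈ X.C)
    {w : Fin P.n} {r : ℕ} (h : (X.phaseHeard w v r).Nonempty) :
    X.H v (X.t v r) ≤ X.phaseStamp w v r :=
  hX.H_mono hv (hX.t_nonneg v hv r) (le_csInf h fun _ hs => hX.le_of_H_le hv hs.2.1 hs.2.2.1)

theorem phaseStamp_self_le (hX : X.IsExecution) (hv : v ∈ X.C) (hP : P.Admissible) (r : ℕ) :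
    X.phaseStamp v v r ≤ X.H v (X.t v r) + (P.τ₁ + P.τ₂) := by
  have h12 := add_pos hP.τ₁_pos hP.τ₂_pos
  rw [phaseStamp]
  rcases (X.phaseHeard v v r).eq_empty_or_nonempty with h | h
  -- If nothing is heard the infimum is `0`, and `H_v(0)` is no later than the start of the round.
  · rw [h, Real.sInf_empty]
    linarith [hX.H_mono hv le_rfl (hX.t_nonneg v hv r)]
  · have hbdd : ∀ s ∈ X.phaseHeard v v r, X.t v r ≤ s :=
      fun _ hs => hX.le_of_H_le hv hs.2.1 hs.2.2.1
    obtain ⟨s, hs⟩ := h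
    have h1 : X.H v (sInf (X.phaseHeard v v r)) ≤ X.H v s :=
      hX.H_mono hv ((hX.t_nonneg v hv r).trans (le_csInf ⟨s, hs⟩ hbdd))
        (csInf_le ⟨_, hbdd⟩ hs)
    have h2 : X.H v s ≤ X.localPhaseEnd v r := hs.2.2.2
    have h3 := div_le_self hP.τ₁_pos.le (hX.μ_mem hv hP.one_lt r).1
    have h4 := div_le_self hP.τ₂_pos.le (hX.μ_mem hv hP.one_lt (r + 1)).1
    rw [localPhaseEnd, localPulse] at h2
    linarith

/-- No assumption on the run is needed here: windows are short compared to a round. -/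
theorem neg_le_Δ (hX : X.IsExecution) (hv : v ∈ X.C) (hP : P.Admissible)
    (r : ℕ) : -(P.τ₁ + P.τ₂) ≤ X.Δ v r := by
  have h12 := add_pos hP.τ₁_pos hP.τ₂_pos
  refine le_agreementMidpoint (by linarith) fun w => ?_
  rw [phaseEntry]
  split_ifs with h
  · refine Or.inr ⟨_, rfl, ?_⟩
    have h1 := hX.phaseStamp_ge hv h
    have h2 := hX.phaseStamp_self_le hv hP r
    rw [le_div_iff₀ (by linarith [hP.one_lt])]
    have h3 : 0 ≤ (P.τ₁ + P.τ₂) * (P.ϑ - 1) := mul_nonneg h12.le (by linarith [hP.one_lt])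
    linarith
  · exact Or.inl rfl

theorem round_pos (hX : X.IsExecution) (hv : v ∈ X.C) (hP : P.Admissible)
    (r : ℕ) : P.ϑbar * P.U < P.T + X.Δ v r := by
  have h1 : P.ϑbar * P.U ≤ P.ϑbar * (P.e₁ + P.U) :=
    mul_le_mul_of_nonneg_left (by linarith [hP.e₁_pos]) (by linarith [hP.ϑbar_gt])
  linarith [hX.neg_le_Δ hv hP r, hP.T_ge, hP.τ₃_pos, hP.τ₄_pos]

theorem round_pos' (hX : X.IsExecution) (hv : v ∈ X.C) (hP : P.Admissible)
    (r : ℕ) : 0 < P.T + X.Δ v r :=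
  (mul_nonneg (by linarith [hP.ϑbar_gt]) hP.U_nonneg).trans_lt (hX.round_pos hv hP r)

/-- Holds for every round without any synchrony. Inside the induction over rounds nothing is known
about the future, yet pulses of later rounds must not arrive before those of the current one; a gap
of `U` between sending times precludes overtaking. -/
theorem p_add_U_le (hX : X.IsExecution) (hv : v ∈ X.C) (hP : P.Admissible)
    (r : ℕ) : X.p v (r + 1) + P.U ≤ X.p v (r + 2) := by
  have hμ := hX.μ_mem hv hP.one_lt (r + 1)
  obtain ⟨_, h, _⟩ := hX.elapsed hv hP.one_lt (hX.p_nonneg v hv r) (hX.p_nonneg v hv (r + 1))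
    hμ.1 hμ.2 (hX.round_pos' hv hP r).le (hX.pulse_succ hv r)
  have h2 := lt_of_mul_lt_mul_left ((hX.round_pos hv hP r).trans_le h)
    (by linarith [hP.ϑbar_gt])
  linarith

theorem p_mono (hX : X.IsExecution) (hv : v ∈ X.C) (hP : P.Admissible)
    {r r' : ℕ} (h : r ≤ r') : X.p v (r + 1) ≤ X.p v (r' + 1) := by
  induction r', h using Nat.le_induction with
  | base => rfl
  | succ k _ ih => linarith [hX.p_add_U_le hv hP k, hP.U_nonneg]

theorem p_le_q (hX : X.IsExecution) (hv : v ∈ X.C) (hP : P.Admissible) (r : ℕ) :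
    X.p v (r + 1) ≤ X.q v (r + 1) ∧ P.τ₂ + P.τ₃ ≤ P.ϑbar * (X.q v (r + 1) - X.p v (r + 1)) ∧
      X.q v (r + 1) - X.p v (r + 1) ≤ P.τ₂ + P.τ₃ := by
  have hμ := hX.μ_mem hv hP.one_lt (r + 1)
  exact hX.elapsed hv hP.one_lt (hX.p_nonneg v hv r) (hX.q_nonneg v hv r) hμ.1 hμ.2
    (by linarith [hP.τ₂_pos, hP.τ₃_pos]) (hX.freq_pulse' hv r)

theorem t_le_p (hX : X.IsExecution) (hv : v ∈ X.C) (hP : P.Admissible) (r : ℕ) :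
    X.t v r ≤ X.p v (r + 1) ∧ P.τ₁ ≤ P.ϑbar * (X.p v (r + 1) - X.t v r) := by
  have hμ := hX.μ_mem hv hP.one_lt r
  obtain ⟨h1, h2, _⟩ := hX.elapsed hv hP.one_lt (hX.t_nonneg v hv r) (hX.p_nonneg v hv r) hμ.1 hμ.2
    hP.τ₁_pos.le (hX.pulse' hv r)
  exact ⟨h1, h2⟩

end SyncRun.IsExecution

/-! ### Reception windows and phase agreement in a synchronized round. -/

theorem exists_bounds_of_pairwise {ι : Type*} {C : Finset ι} (hC : C.Nonempty) {y : ι → ℝ} {e : ℝ}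
    (h : ∀ v ∈ C, ∀ w ∈ C, y v - y w ≤ e) :
    ∃ lo hi, (∀ w ∈ C, lo ≤ y w ∧ y w ≤ hi) ∧ hi - lo ≤ e := by
  obtain ⟨i, hi, hmin⟩ := C.exists_min_image y hC
  obtain ⟨j, hj, hmax⟩ := C.exists_max_image y hC
  exact ⟨y i, y j, fun w hw => ⟨hmin w hw, hmax w hw⟩, h j hj i hi⟩

namespace SyncRun

variable {P : SyncParams}

/-- All correct nodes send the first pulse of round `r + 1` within time `e₁`, after having received
all pulses of correct nodes from earlier rounds. -/
structure Synced (X : SyncRun P) (r : ℕ) : Prop where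
  skew_le : ∀ v ∈ X.C, ∀ w ∈ X.C, X.p v (r + 1) - X.p w (r + 1) ≤ P.e₁
  past : ∀ v ∈ X.C, ∀ w ∈ X.C, ∀ r' < r, X.b w v (r' + 1) < X.t v r

namespace IsExecution

variable {X : SyncRun P}
  {v : Fin P.n} {w : Fin P.n} {r : ℕ}

theorem H_le_add_div (hX : X.IsExecution) (hP : P.Admissible) (hv : v ∈ X.C)
    {s s' x μ : ℝ} (hs : 0 ≤ s) (hs' : 0 ≤ s') (hμ : μ ∈ Set.Icc 1 (P.ϑ ^ 2))
    (hx : 0 ≤ x) (h : P.ϑbar * (s' - s) ≤ x) : X.H v s' ≤ X.H v s + x / μ := by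
  have hμ0 : 0 < μ := by linarith [hμ.1]
  rcases le_total s' s with h' | h'
  · linarith [hX.H_mono hv hs' h', div_nonneg hx hμ0.le]
  · have h1 := (hX.drift hv hs h').2
    have h2 : P.ϑ * (s' - s) ≤ x / μ := by
      rw [le_div_iff₀ hμ0]
      refine le_trans ?_ h
      rw [SyncParams.ϑbar, show P.ϑ ^ 3 * (s' - s) = P.ϑ * (s' - s) * P.ϑ ^ 2 by ring]
      exact mul_le_mul_of_nonneg_left hμ.2
        (mul_nonneg (by linarith [hP.one_lt]) (by linarith))
    linarith

theorem add_div_lt_H (hX : X.IsExecution) (hv : v ∈ X.C)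
    {s s' x μ : ℝ} (hs : 0 ≤ s) (hμ : 1 ≤ μ) (hx : 0 ≤ x) (h : s + x < s') :
    X.H v s + x / μ < X.H v s' := by
  linarith [(hX.drift hv hs (by linarith : s ≤ s')).1, div_le_self hx hμ]

theorem a_nonneg (hX : X.IsExecution) (hP : P.Admissible) (hv : v ∈ X.C) (hw : w ∈ X.C) :
    0 ≤ X.a w v (r + 1) := by
  linarith [(hX.phase_delay w hw v hv r).1, hX.p_nonneg w hw r, hP.U_le]

theorem U_le_q_sub_p (hX : X.IsExecution) (hP : P.Admissible) (hw : w ∈ X.C) :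
    X.p w (r + 1) + P.U ≤ X.q w (r + 1) := by
  have h1 := (hX.p_le_q hw hP r).2.1
  have h2 : P.ϑbar * P.U ≤ P.ϑbar * (P.e₁ + P.d) :=
    mul_le_mul_of_nonneg_left (by linarith [hP.e₁_pos, hP.U_le]) (by linarith [hP.ϑbar_gt])
  have h3 : P.ϑbar * P.U ≤ P.ϑbar * (X.q w (r + 1) - X.p w (r + 1)) := by
    linarith [hP.constraints.tau_two, hP.τ₃_pos]
  linarith [le_of_mul_le_mul_left h3 (by linarith [hP.ϑbar_gt])]

theorem a_le_b (hX : X.IsExecution) (hP : P.Admissible) (hv : v ∈ X.C) (hw : w ∈ X.C) :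
    X.a w v (r + 1) ≤ X.b w v (r + 1) := by
  linarith [(hX.phase_delay w hw v hv r).2, (hX.freq_delay w hw v hv r).1,
    hX.U_le_q_sub_p hP hw (r := r)]

theorem a_le_future (hX : X.IsExecution) (hP : P.Admissible) (hv : v ∈ X.C) (hw : w ∈ X.C)
    {r' : ℕ} (h : r < r') : X.a w v (r + 1) ≤ X.a w v (r' + 1) := by
  linarith [(hX.phase_delay w hw v hv r).2, (hX.phase_delay w hw v hv r').1,
    hX.p_mono hw hP (Nat.succ_le_of_lt h), hX.p_add_U_le hw hP r]

/-- Since `τ₁ ≥ ϑ̄ e₁`, node `v` starts listening at least `e₁` before its own pulse, hence before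
any correct node sends. -/
theorem t_le_a (hX : X.IsExecution) (hP : P.Admissible) (hv : v ∈ X.C) (hw : w ∈ X.C)
    (hS : X.Synced r) :
    X.t v r ≤ X.a w v (r + 1) := by
  have h1 := (hX.t_le_p hv hP r).2
  have h2 := le_of_mul_le_mul_left (hP.constraints.tau_one.trans h1) (by linarith [hP.ϑbar_gt])
  linarith [(hX.phase_delay w hw v hv r).1, hS.skew_le v hv w hw, hP.U_le]

theorem H_a_le (hX : X.IsExecution) (hP : P.Admissible) (hv : v ∈ X.C) (hw : w ∈ X.C)
    (hS : X.Synced r) :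
    X.H v (X.a w v (r + 1)) ≤ X.localPhaseEnd v r := by
  rw [localPhaseEnd, ← hX.pulse v hv r]
  refine hX.H_le_add_div hP hv (hX.p_nonneg v hv r) (hX.a_nonneg hP hv hw)
    (hX.μ_mem hv hP.one_lt (r + 1)) hP.τ₂_pos.le (le_trans ?_ hP.constraints.tau_two)
  refine mul_le_mul_of_nonneg_left ?_ (by linarith [hP.ϑbar_gt])
  linarith [(hX.phase_delay w hw v hv r).2, hS.skew_le w hw v hv]

/-- Pulses of earlier rounds arrived before the window opened (`Synced.past`), and the spacing of
pulses puts those of later rounds behind the current one. -/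
theorem isLeast_phaseHeard (hX : X.IsExecution) (hP : P.Admissible) (hv : v ∈ X.C)
    (hw : w ∈ X.C) (hS : X.Synced r) :
    IsLeast (X.phaseHeard w v r) (X.a w v (r + 1)) := by
  refine ⟨⟨?_, hX.a_nonneg hP hv hw, hX.H_mono hv (hX.t_nonneg v hv r) (hX.t_le_a hP hv hw hS),
    hX.H_a_le hP hv hw hS⟩, ?_⟩
  · rw [hX.recv_correct w hw v hv]
    exact ⟨r, Or.inl rfl⟩
  · rintro s ⟨hs, hs0, hs1, -⟩
    have hts := hX.le_of_H_le hv hs0 hs1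
    rw [hX.recv_correct w hw v hv] at hs
    obtain ⟨r', hr'⟩ := hs
    have hle : X.a w v (r' + 1) ≤ s ∧ s ≤ X.b w v (r' + 1) := by
      have := hX.a_le_b hP hv hw (r := r')
      rcases hr' with rfl | rfl
      · exact ⟨le_rfl, this⟩
      · exact ⟨this, le_rfl⟩
    rcases lt_trichotomy r' r with h | rfl | h
    · linarith [hS.past v hv w hw r' h]
    · exact hle.1
    · exact (hX.a_le_future hP hv hw h).trans hle.1

theorem phaseHeard_nonempty (hX : X.IsExecution) (hP : P.Admissible) (hv : v ∈ X.C)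
    (hw : w ∈ X.C) (hS : X.Synced r) :
    (X.phaseHeard w v r).Nonempty :=
  ⟨_, (hX.isLeast_phaseHeard hP hv hw hS).1⟩

theorem phaseStamp_eq (hX : X.IsExecution) (hP : P.Admissible) (hv : v ∈ X.C) (hw : w ∈ X.C)
    (hS : X.Synced r) :
    X.phaseStamp w v r = X.H v (X.a w v (r + 1)) := by
  rw [phaseStamp, (hX.isLeast_phaseHeard hP hv hw hS).csInf_eq]

/-- Delay uncertainty contributes `U`. Dividing by the mean rate `(ϑ + 1)/2` leaves a relative drift
error of at most `(ϑ - 1)/(ϑ + 1) ≤ (ϑ - 1)/2` on an interval of length at most `e + U`. -/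
theorem phase_estimate (hX : X.IsExecution) (hP : P.Admissible) (hv : v ∈ X.C) (hw : w ∈ X.C)
    (hS : X.Synced r)
    {e : ℝ}
    (he : ∀ v ∈ X.C, ∀ w ∈ X.C, X.p v (r + 1) - X.p w (r + 1) ≤ e) :
    ∃ x : ℝ, X.phaseEntry v r w = x ∧
      |x - (X.p w (r + 1) - X.p v (r + 1))| ≤ P.U + (P.ϑ - 1) / 2 * (e + P.U) := by
  refine ⟨_, by rw [phaseEntry, if_pos (hX.phaseHeard_nonempty hP hv hw hS)], ?_⟩
  rw [hX.phaseStamp_eq hP hv hw hS, hX.phaseStamp_eq hP hv hv hS]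
  have hθ := hP.one_lt
  have hw1 := hX.phase_delay w hw v hv r
  have hv1 := hX.phase_delay v hv v hv r
  have h1 := he v hv w hw
  have h2 := he w hw v hv
  set y := X.a w v (r + 1) - X.a v v (r + 1) with hy
  have hy1 : |y - (X.p w (r + 1) - X.p v (r + 1))| ≤ P.U :=
    abs_le.mpr ⟨by linarith [hw1.1, hv1.2], by linarith [hw1.2, hv1.1]⟩
  have hy2 : |y| ≤ e + P.U := by
    obtain ⟨_, _⟩ := abs_le.mp hy1
    exact abs_le.mpr ⟨by linarith, by linarith⟩
  have hkey : |2 * (X.H v (X.a w v (r + 1)) - X.H v (X.a v v (r + 1))) / (P.ϑ + 1) - y|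
      ≤ (P.ϑ - 1) / 2 * |y| := by
    have aux : ∀ s s' : ℝ, 0 ≤ s → s ≤ s' →
        |2 * (X.H v s' - X.H v s) / (P.ϑ + 1) - (s' - s)| ≤ (P.ϑ - 1) / 2 * (s' - s) := by
      intro s s' hs hss
      obtain ⟨hl, hu⟩ := hX.drift hv hs hss
      have hm : 0 ≤ (P.ϑ - 1) ^ 2 * (s' - s) := mul_nonneg (sq_nonneg _) (by linarith)
      have hpos : 0 < P.ϑ + 1 := by linarith
      have h1 : (s' - s) - (P.ϑ - 1) / 2 * (s' - s) ≤
          2 * (X.H v s' - X.H v s) / (P.ϑ + 1) := by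
        rw [le_div_iff₀ hpos]
        nlinarith
      have h2 : 2 * (X.H v s' - X.H v s) / (P.ϑ + 1) ≤
          (s' - s) + (P.ϑ - 1) / 2 * (s' - s) := by
        rw [div_le_iff₀ hpos]
        nlinarith
      exact abs_le.mpr ⟨by linarith, by linarith⟩
    rcases le_total (X.a v v (r + 1)) (X.a w v (r + 1)) with h | h
    · rw [abs_of_nonneg (by linarith : 0 ≤ y)]
      exact aux _ _ (hX.a_nonneg hP hv hv) h
    · rw [abs_of_nonpos (by linarith : y ≤ 0)]
      have := aux _ _ (hX.a_nonneg hP hv hw) h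
      rw [← abs_neg] at this
      convert this using 2 <;> rw [hy] <;> ring
  calc _ ≤ |2 * (X.H v (X.a w v (r + 1)) - X.H v (X.a v v (r + 1))) / (P.ϑ + 1) - y|
        + |y - (X.p w (r + 1) - X.p v (r + 1))| := abs_sub_le _ _ _
    _ ≤ (P.ϑ - 1) / 2 * |y| + P.U := add_le_add hkey hy1
    _ ≤ _ := by
      have := mul_le_mul_of_nonneg_left hy2 (by linarith : 0 ≤ (P.ϑ - 1) / 2)
      linarith

theorem exists_phase_bounds (hX : X.IsExecution) (hP : P.Admissible) (hv : v ∈ X.C)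
    (hS : X.Synced r)
    {e : ℝ}
    (he : ∀ v ∈ X.C, ∀ w ∈ X.C, X.p v (r + 1) - X.p w (r + 1) ≤ e) :
    ∃ lo m hi, hi - lo ≤ e ∧ lo ≤ m ∧ m ≤ hi ∧
      ∀ w ∈ X.C, (lo ≤ X.p w (r + 1) ∧ X.p w (r + 1) ≤ hi) ∧
        (lo + m) / 2 - (P.U + (P.ϑ - 1) / 2 * (e + P.U)) ≤ X.Δ w r + X.p w (r + 1) ∧
        X.Δ w r + X.p w (r + 1) ≤ (m + hi) / 2 + (P.U + (P.ϑ - 1) / 2 * (e + P.U)) := by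
  obtain ⟨lo, hi, hy, hlohi⟩ := exists_bounds_of_pairwise ⟨v, hv⟩ he
  obtain ⟨i, hiC, h⟩ := exists_agreementMidpoint_bounds (SyncParams.three_mul_f_lt v.pos) X.C
    hX.card_le fun w => X.p w (r + 1)
  exact ⟨lo, X.p i (r + 1), hi, hlohi, (hy i hiC).1, (hy i hiC).2, fun w hw => ⟨hy w hw,
    h (X.phaseEntry w r) (X.p w (r + 1)) _ lo hi hy
      fun u hu => hX.phase_estimate hP hw hu hS he⟩⟩

theorem abs_Δ_lt (hX : X.IsExecution) (hP : P.Admissible) (hv : v ∈ X.C) (hS : X.Synced r) :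
    |X.Δ v r| < P.ϑbar * (P.e₁ + P.U) := by
  obtain ⟨lo, m, hi, h1, h2, h3, h⟩ := hX.exists_phase_bounds hP hv hS hS.skew_le
  obtain ⟨⟨h4, h5⟩, h6, h7⟩ := h v hv
  have h8 : 0 < (P.ϑbar - (P.ϑ + 1) / 2) * (P.e₁ + P.U) :=
    mul_pos (by linarith [hP.ϑ_lt_ϑbar, hP.one_lt]) (by linarith [hP.e₁_pos, hP.U_nonneg])
  rw [abs_lt]
  constructor <;> nlinarith

theorem round_rest (hX : X.IsExecution) (hP : P.Admissible) (hv : v ∈ X.C) (hS : X.Synced r) :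
    P.τ₁ + P.τ₂ + P.τ₃ + P.τ₄ < P.T + X.Δ v r := by
  linarith [(abs_lt.mp (hX.abs_Δ_lt hP hv hS)).1, hP.T_ge]

theorem q_add_U_le (hX : X.IsExecution) (hP : P.Admissible) (hw : w ∈ X.C) (hS : X.Synced r) :
    X.q w (r + 1) + P.U ≤ X.p w (r + 2) := by
  have hμ := hX.μ_mem hw hP.one_lt (r + 1)
  have hrest := hX.round_rest hP hw hS
  have hH : X.H w (X.p w (r + 2)) =
      X.H w (X.q w (r + 1)) + (P.T + X.Δ w r - (P.τ₂ + P.τ₃)) / X.μ w (r + 1) := by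
    rw [hX.pulse_succ hw, hX.freq_pulse' hw]
    ring
  obtain ⟨_, h, _⟩ := hX.elapsed hw hP.one_lt (hX.q_nonneg w hw r) (hX.p_nonneg w hw (r + 1))
    hμ.1 hμ.2 (by linarith [hP.τ₁_pos, hP.τ₄_pos]) hH
  have h2 : P.ϑbar * P.U ≤ P.ϑbar * (P.e₁ + P.d) :=
    mul_le_mul_of_nonneg_left (by linarith [hP.e₁_pos, hP.U_le]) (by linarith [hP.ϑbar_gt])
  have h3 : P.ϑbar * P.U ≤ P.ϑbar * (X.p w (r + 2) - X.q w (r + 1)) := by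
    linarith [hP.τ₄_ge', hP.τ₁_pos]
  linarith [le_of_mul_le_mul_left h3 (by linarith [hP.ϑbar_gt])]

/-- The purpose of the constraint on `τ₃`: second pulses arrive only after every correct node has
stopped listening for first ones. -/
theorem p_add_τ₂_lt_b (hX : X.IsExecution) (hP : P.Admissible) (hv : v ∈ X.C) (hw : w ∈ X.C)
    (hS : X.Synced r) :
    X.p v (r + 1) + P.τ₂ < X.b w v (r + 1) := by
  have h1 := (hX.p_le_q hw hP r).2.1
  have h2 : 0 < (P.ϑbar - 1) * P.τ₁ := mul_pos (by linarith [hP.ϑbar_gt]) hP.τ₁_pos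
  have h3 := mul_le_mul_of_nonneg_left (hS.skew_le v hv w hw)
    (by linarith [hP.ϑbar_gt] : 0 ≤ P.ϑbar)
  have h4 : P.ϑbar * (X.p v (r + 1) + P.τ₂) < P.ϑbar * X.q w (r + 1) := by
    linarith [hP.τ₃_ge]
  linarith [lt_of_mul_lt_mul_left h4 (by linarith [hP.ϑbar_gt]), (hX.freq_delay w hw v hv r).1,
    hP.U_le]

theorem b_nonneg (hX : X.IsExecution) (hP : P.Admissible) (hv : v ∈ X.C) (hw : w ∈ X.C)
    (hS : X.Synced r) :
    0 ≤ X.b w v (r + 1) := by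
  linarith [hX.p_add_τ₂_lt_b hP hv hw hS, hX.p_nonneg v hv r, hP.τ₂_pos]

theorem H_b_le (hX : X.IsExecution) (hP : P.Admissible) (hv : v ∈ X.C) (hw : w ∈ X.C)
    (hS : X.Synced r) :
    X.H v (X.b w v (r + 1)) ≤ X.localFreqEnd v r := by
  rw [localFreqEnd, ← hX.pulse v hv r]
  refine hX.H_le_add_div hP hv (hX.p_nonneg v hv r) (hX.b_nonneg hP hv hw hS)
    (hX.μ_mem hv hP.one_lt (r + 1)) (by linarith [hP.τ₂_pos, hP.τ₃_pos, hP.τ₄_pos]) ?_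
  have h1 : X.b w v (r + 1) - X.p v (r + 1) ≤ P.e₁ + P.d + (P.τ₂ + P.τ₃) := by
    linarith [(hX.freq_delay w hw v hv r).2, hS.skew_le w hw v hv, (hX.p_le_q hw hP r).2.2]
  have h2 := mul_le_mul_of_nonneg_left h1 (by linarith [hP.ϑbar_gt] : 0 ≤ P.ϑbar)
  linarith [hP.τ₄_ge]

theorem isLeast_freqHeard (hX : X.IsExecution) (hP : P.Admissible) (hv : v ∈ X.C) (hw : w ∈ X.C)
    (hS : X.Synced r) :
    IsLeast (X.freqHeard w v r) (X.b w v (r + 1)) := by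
  have hp0 := hX.p_nonneg v hv r
  have hμ := (hX.μ_mem hv hP.one_lt (r + 1)).1
  refine ⟨⟨?_, hX.b_nonneg hP hv hw hS, ?_, hX.H_b_le hP hv hw hS⟩, ?_⟩
  · rw [hX.recv_correct w hw v hv]
    exact ⟨r, Or.inr rfl⟩
  · rw [localPhaseEnd, ← hX.pulse v hv r]
    exact hX.add_div_lt_H hv hp0 hμ hP.τ₂_pos.le (hX.p_add_τ₂_lt_b hP hv hw hS)
  · rintro s ⟨hs, hs0, hs1, -⟩
    have hps : X.p v (r + 1) < s := by
      refine hX.lt_of_H_lt hv hs0 (lt_of_le_of_lt ?_ hs1)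
      rw [localPhaseEnd, ← hX.pulse v hv r]
      linarith [div_nonneg hP.τ₂_pos.le (by linarith : 0 ≤ X.μ v (r + 1))]
    rw [hX.recv_correct w hw v hv] at hs
    obtain ⟨r', hr'⟩ := hs
    rcases lt_trichotomy r' r with h | rfl | h
    · have h1 : s ≤ X.b w v (r' + 1) := by
        rcases hr' with rfl | rfl
        · exact hX.a_le_b hP hv hw
        · rfl
      linarith [hS.past v hv w hw r' h, (hX.t_le_p hv hP r).1]
    · rcases hr' with rfl | rfl
      -- A first pulse of this round arrives by the end of the phase window, which the frequency
      -- window excludes.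
      · exact absurd (hX.H_a_le hP hv hw hS) (not_le.mpr hs1)
      · rfl
    · have h1 : X.a w v (r' + 1) ≤ s := by
        rcases hr' with rfl | rfl
        · rfl
        · exact hX.a_le_b hP hv hw
      linarith [(hX.phase_delay w hw v hv r').1, (hX.freq_delay w hw v hv r).2,
        hX.p_mono hw hP (Nat.succ_le_of_lt h), hX.q_add_U_le hP hw hS]

theorem freqHeard_nonempty (hX : X.IsExecution) (hP : P.Admissible) (hv : v ∈ X.C)
    (hw : w ∈ X.C) (hS : X.Synced r) :
    (X.freqHeard w v r).Nonempty :=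
  ⟨_, (hX.isLeast_freqHeard hP hv hw hS).1⟩

theorem freqStamp_eq (hX : X.IsExecution) (hP : P.Admissible) (hv : v ∈ X.C) (hw : w ∈ X.C)
    (hS : X.Synced r) :
    X.freqStamp w v r = X.H v (X.b w v (r + 1)) := by
  rw [freqStamp, (hX.isLeast_freqHeard hP hv hw hS).csInf_eq]

theorem localFreqEnd_lt (hX : X.IsExecution) (hP : P.Admissible) (hv : v ∈ X.C) (hS : X.Synced r) :
    X.localFreqEnd v r < X.H v (X.t v (r + 1)) := by
  rw [hX.t_step v hv r, localFreqEnd]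
  have hμ : 0 < X.μ v (r + 1) := by linarith [(hX.μ_mem hv hP.one_lt (r + 1)).1]
  have := div_lt_div_of_pos_right
    (by linarith [hX.round_rest hP hv hS] : P.τ₂ + P.τ₃ + P.τ₄ < P.T - P.τ₁ + X.Δ v r) hμ
  linarith

theorem b_lt_t_succ (hX : X.IsExecution) (hP : P.Admissible) (hv : v ∈ X.C) (hw : w ∈ X.C)
    (hS : X.Synced r) :
    X.b w v (r + 1) < X.t v (r + 1) :=
  hX.lt_of_H_lt hv (hX.t_nonneg v hv _)
    ((hX.H_b_le hP hv hw hS).trans_lt (hX.localFreqEnd_lt hP hv hS))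

theorem past_succ (hX : X.IsExecution) (hP : P.Admissible) (hv : v ∈ X.C) (hw : w ∈ X.C)
    (hS : X.Synced r) :
    ∀ r' < r + 1, X.b w v (r' + 1) < X.t v (r + 1) := by
  intro r' hr'
  have h1 := hX.b_lt_t_succ hP hv hw hS
  rcases Nat.lt_succ_iff_lt_or_eq.mp hr' with h | rfl
  · linarith [hS.past v hv w hw r' h, hX.t_le_a hP hv hw hS, hX.a_le_b hP hv hw (r := r)]
  · exact h1

/-- Contraction of the synchronization error in one round, in terms of the spread `σ` that
differing clock rates `ρ` cause. -/
theorem skew_succ_le (hX : X.IsExecution) (hP : P.Admissible) (hS : X.Synced r)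
    {e σ : ℝ} (he : ∀ v ∈ X.C, ∀ w ∈ X.C, X.p v (r + 1) - X.p w (r + 1) ≤ e)
    {ρ : Fin P.n → ℝ} (hρ : ∀ v ∈ X.C, 1 ≤ ρ v ∧ ρ v ≤ P.ϑbar)
    (hp : ∀ v ∈ X.C, X.p v (r + 2) = X.p v (r + 1) + (P.T + X.Δ v r) / ρ v)
    (hσ : ∀ v ∈ X.C, ∀ w ∈ X.C, P.T / ρ v - P.T / ρ w ≤ σ) :
    ∀ v ∈ X.C, ∀ w ∈ X.C, X.p v (r + 2) - X.p w (r + 2) ≤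
      (1 / 2 + (1 - 1 / P.ϑbar) / 2 + (P.ϑ - 1)) * e + (1 + P.ϑ) * P.U + σ := by
  intro v hv w hw
  obtain ⟨lo, m, hi, h1, h2, h3, h⟩ := hX.exists_phase_bounds hP hv hS he
  obtain ⟨⟨v1, v2⟩, v3, v4⟩ := h v hv
  obtain ⟨⟨w1, w2⟩, w3, w4⟩ := h w hw
  have he0 : 0 ≤ e := by linarith [he v hv v hv]
  set δ := P.U + (P.ϑ - 1) / 2 * (e + P.U) with hδ
  have hδ0 : 0 ≤ δ := add_nonneg hP.U_nonneg
    (mul_nonneg (by linarith [hP.one_lt]) (add_nonneg he0 hP.U_nonneg))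
  have hk : ∀ u ∈ X.C, 1 / P.ϑbar ≤ 1 / ρ u ∧ 1 / ρ u ≤ 1 := fun u hu =>
    ⟨one_div_le_one_div_of_le (by linarith [(hρ u hu).1]) (hρ u hu).2,
      (div_le_one (by linarith [(hρ u hu).1])).mpr (hρ u hu).1⟩
  have hc : 0 < 1 / P.ϑbar := one_div_pos.mpr (by linarith [hP.ϑbar_gt])
  have hσ' := hσ v hv w hw
  rw [hp v hv, hp w hw]
  obtain ⟨kv1, kv2⟩ := hk v hv
  obtain ⟨kw1, kw2⟩ := hk w hw
  rw [div_eq_mul_one_div _ (ρ v), div_eq_mul_one_div _ (ρ w)] at hσ' ⊢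
  generalize 1 / ρ v = kv at *
  generalize 1 / ρ w = kw at *
  generalize 1 / P.ϑbar = c at *
  -- With `k = 1/ρ`, `p + k Δ = (1 - k) p + k (p + Δ)` is a convex combination of the old pulse time
  -- and the agreed one. The least weight `k = c = 1/ϑ̄` on the latter is the worst case.
  have up : X.p v (r + 1) + (P.T + X.Δ v r) * kv ≤ P.T * kv + hi - c * ((hi - m) / 2) + δ := by
    nlinarith [mul_nonneg (sub_nonneg.mpr kv2) (sub_nonneg.mpr v2),
      mul_nonneg (hc.le.trans kv1) (sub_nonneg.mpr v4),
      mul_nonneg (sub_nonneg.mpr kv1) (sub_nonneg.mpr h3),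
      mul_nonneg (sub_nonneg.mpr kv2) hδ0]
  have down : P.T * kw + lo + c * ((m - lo) / 2) - δ ≤ X.p w (r + 1) + (P.T + X.Δ w r) * kw := by
    nlinarith [mul_nonneg (sub_nonneg.mpr kw2) (sub_nonneg.mpr w1),
      mul_nonneg (hc.le.trans kw1) (sub_nonneg.mpr w3),
      mul_nonneg (sub_nonneg.mpr kw1) (sub_nonneg.mpr h2),
      mul_nonneg (sub_nonneg.mpr kw2) hδ0]
  have hc1 : c ≤ 1 := kv1.trans kv2
  have h5 : (1 - c / 2) * (hi - lo) ≤ (1 - c / 2) * e :=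
    mul_le_mul_of_nonneg_left h1 (by linarith)
  rw [hδ] at up down
  linarith

end IsExecution

end SyncRun

/-! ### Synchrony of all rounds and estimation of clock rates. -/

namespace SyncParams.Admissible

variable {P : SyncParams}

theorem one_sub_inv_le (hP : P.Admissible) : 1 - 1 / P.ϑbar ≤ P.ϑbar - 1 := by
  have h := hP.ϑbar_gt
  rw [sub_le_comm, le_div_iff₀ (by linarith)]
  nlinarith [sq_nonneg (P.ϑbar - 1)]

theorem contraction_le (hP : P.Admissible) :
    1 / 2 + (1 - 1 / P.ϑbar) / 2 + (P.ϑ - 1) ≤ 1 / 2 + (P.ϑbar - 1) := by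
  linarith [hP.one_sub_inv_le, sub_one_le_ϑbar hP.one_lt, hP.ϑbar_gt]

/-- The error bound for the estimates of clock rates is nonnegative. -/
theorem freq_error_nonneg (hP : P.Admissible) :
    0 ≤ P.ϑbar * P.U / (P.τ₂ + P.τ₃) + (P.ϑbar - 1) ^ 2 + 2 * P.ϑ ^ 2 * P.ν * P.T := by
  have h1 : 0 ≤ P.ϑbar * P.U / (P.τ₂ + P.τ₃) :=
    div_nonneg (mul_nonneg (by linarith [hP.ϑbar_gt]) hP.U_nonneg)
      (by linarith [hP.τ₂_pos, hP.τ₃_pos])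
  have h2 : 0 ≤ 2 * P.ϑ ^ 2 * P.ν * P.T :=
    mul_nonneg (mul_nonneg (by positivity) hP.nu_pos.le) hP.T_pos.le
  linarith [sq_nonneg (P.ϑbar - 1)]

end SyncParams.Admissible

namespace SyncRun

variable {P : SyncParams}

/-- The rate of the scaled clock of `v` at the first pulse of round `r + 1`. -/
def rate (X : SyncRun P) (v : Fin P.n) (r : ℕ) : ℝ := X.μ v (r + 1) * X.h v (X.p v (r + 1))

namespace IsExecution

variable {X : SyncRun P}

theorem scaled_rate_mem (hX : X.IsExecution) (hP : P.Admissible)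
    {v : Fin P.n} (hv : v ∈ X.C) (r : ℕ) {s : ℝ} (hs : 0 ≤ s) :
    1 ≤ X.μ v r * X.h v s ∧ X.μ v r * X.h v s ≤ P.ϑbar := by
  obtain ⟨m1, m2⟩ := hX.μ_mem hv hP.one_lt r
  obtain ⟨h1, h2⟩ := hX.rate_mem v hv s hs
  refine ⟨one_le_mul_of_one_le_of_one_le m1 h1, ?_⟩
  rw [SyncParams.ϑbar, show P.ϑ ^ 3 = P.ϑ ^ 2 * P.ϑ by ring]
  exact mul_le_mul m2 h2 (by linarith) (by positivity)

theorem scaled_rate_sub_le (hX : X.IsExecution) (hP : P.Admissible)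
    {v : Fin P.n} (hv : v ∈ X.C) (r : ℕ) {s s' D : ℝ} (hs : 0 ≤ s)
    (hs' : 0 ≤ s') (hD : |s' - s| ≤ D) :
    |X.μ v r * X.h v s' - X.μ v r * X.h v s| ≤ P.ϑ ^ 2 * P.ν * D := by
  obtain ⟨m1, m2⟩ := hX.μ_mem hv hP.one_lt r
  have h1 := (hX.rate_lipschitz v hv s s' hs hs').trans
    (mul_le_mul_of_nonneg_left hD hP.nu_pos.le)
  rw [← mul_sub, abs_mul, abs_of_nonneg (by linarith : 0 ≤ X.μ v r), mul_assoc]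
  exact mul_le_mul m2 h1 (abs_nonneg _) (by positivity)

theorem exists_round_rate (hX : X.IsExecution) (hP : P.Admissible)
    {v : Fin P.n} (hv : v ∈ X.C) (r : ℕ) :
    ∃ c ∈ Set.Ioo (X.p v (r + 1)) (X.p v (r + 2)),
      X.p v (r + 2) = X.p v (r + 1) + (P.T + X.Δ v r) / (X.μ v (r + 1) * X.h v c) :=
  hX.exists_elapsed hv (hX.p_nonneg v hv r) (hX.p_nonneg v hv (r + 1))
    (hX.μ_mem hv hP.one_lt (r + 1)).1 (hX.round_pos' hv hP r) (hX.pulse_succ hv r)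

theorem p_succ_sub_le (hX : X.IsExecution) (hP : P.Admissible)
    {v : Fin P.n} (hv : v ∈ X.C) {r : ℕ} (hS : X.Synced r) :
    X.p v (r + 2) - X.p v (r + 1) ≤ 2 * P.T := by
  have hμ := hX.μ_mem hv hP.one_lt (r + 1)
  have h := hX.elapsed hv hP.one_lt (hX.p_nonneg v hv r) (hX.p_nonneg v hv (r + 1))
    hμ.1 hμ.2 (hX.round_pos' hv hP r).le (hX.pulse_succ hv r)
  linarith [(abs_lt.mp (hX.abs_Δ_lt hP hv hS)).2, hP.T_ge, hP.τ₁_pos, hP.τ₂_pos, hP.τ₃_pos,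
    hP.τ₄_pos]

theorem synced_zero (hX : X.IsExecution) (hP : P.Admissible) : X.Synced 0 := by
  refine ⟨fun v hv w hw => ?_, fun _ _ _ _ r' hr' => absurd hr' (Nat.not_lt_zero _)⟩
  have ht : ∀ u ∈ X.C, X.t u 0 ≤ P.F := fun u hu => by
    have h := (hX.drift hu le_rfl (hX.t_nonneg u hu 0)).1
    rw [hX.t_zero u hu] at h
    linarith [(hX.clock_init u hu).1]
  have hθ : 1 < P.ϑ := hP.one_lt
  have hμ : P.ϑ ≤ P.ϑ ^ 2 := by nlinarith
  have hτ := hP.τ₁_pos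
  have hpu : ∀ u ∈ X.C, X.H u (X.p u 1) = X.H u (X.t u 0) + P.τ₁ / P.ϑ := fun u hu => by
    rw [hX.pulse' hu 0, hX.μ_zero u hu]
  have h1 : X.p v 1 - X.t v 0 ≤ P.τ₁ :=
    (hX.elapsed hv hP.one_lt (hX.t_nonneg v hv 0) (hX.p_nonneg v hv 0) hθ.le hμ hτ.le
      (hpu v hv)).2.2
  have h2 : P.τ₁ ≤ P.ϑbar * (X.p w 1 - X.t w 0) :=
    (hX.elapsed hw hP.one_lt (hX.t_nonneg w hw 0) (hX.p_nonneg w hw 0) hθ.le hμ hτ.le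
      (hpu w hw)).2.1
  have h3 : 1 / P.ϑbar * P.τ₁ ≤ X.p w 1 - X.t w 0 := by
    rw [one_div, inv_mul_le_iff₀ (by linarith [hP.ϑbar_gt])]
    exact h2
  change X.p v 1 - X.p w 1 ≤ P.e₁
  linarith [P.initial_le, ht v hv, hX.t_nonneg w hw 0]

/-- Only `ρ ∈ [1, ϑ̄]` is used about the rates, with `ρ` taken at a mean value point of the round.
The resulting spread `(1 - 1/ϑ̄) T` is the one built into `e₁`. -/
theorem synced_succ (hX : X.IsExecution) (hP : P.Admissible)
    {r : ℕ} (hS : X.Synced r) : X.Synced (r + 1) := by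
  refine ⟨fun v hv w hw => ?_, fun v hv w hw => hX.past_succ hP hv hw hS⟩
  have hc : ∀ u : Fin P.n, ∃ c : ℝ, u ∈ X.C → c ∈ Set.Ioo (X.p u (r + 1)) (X.p u (r + 2)) ∧
      X.p u (r + 2) = X.p u (r + 1) + (P.T + X.Δ u r) / (X.μ u (r + 1) * X.h u c) := by
    intro u
    by_cases hu : u ∈ X.C
    · obtain ⟨c, h⟩ := hX.exists_round_rate hP hu r
      exact ⟨c, fun _ => h⟩
    · exact ⟨0, fun h => absurd h hu⟩
  choose c hc using hc
  have hρ : ∀ u ∈ X.C, 1 ≤ X.μ u (r + 1) * X.h u (c u) ∧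
      X.μ u (r + 1) * X.h u (c u) ≤ P.ϑbar := fun u hu =>
    hX.scaled_rate_mem hP hu (r + 1) ((hX.p_nonneg u hu r).trans (hc u hu).1.1.le)
  have h := hX.skew_succ_le hP hS hS.skew_le hρ (fun u hu => (hc u hu).2)
    (σ := (1 - 1 / P.ϑbar) * P.T) (fun v hv w hw => ?_) v hv w hw
  · refine h.trans (le_trans ?_ hP.fixpoint)
    have h1 := mul_le_mul_of_nonneg_right
      (hP.contraction_le.trans (SyncParams.βbar_ge hP.one_lt)) hP.e₁_pos.le
    have h2 := mul_le_mul_of_nonneg_right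
      (by linarith [hP.ϑ_lt_ϑbar, hP.ϑbar_gt] : 1 + P.ϑ ≤ 3 * P.ϑbar - 1) hP.U_nonneg
    linarith
  · have h1 := div_le_self hP.T_pos.le (hρ v hv).1
    have h2 := div_le_div_of_nonneg_left hP.T_pos.le (by linarith [(hρ w hw).1]) (hρ w hw).2
    rw [sub_mul, one_mul, one_div_mul_eq_div]
    linarith

theorem synced (hX : X.IsExecution) (hP : P.Admissible) (r : ℕ) : X.Synced r := by
  induction r with
  | zero => exact hX.synced_zero hP
  | succ r ih => exact hX.synced_succ hP ih

variable {v w : Fin P.n}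

/-- A round lasts at most `2T`, so the mean rate over it differs from the rate at its pulse by at
most `2 ϑ² ν T` at each of the two nodes. -/
theorem skew_succ_le_of_rate (hX : X.IsExecution) (hP : P.Admissible) (r : ℕ) {e s : ℝ}
    (he : ∀ v ∈ X.C, ∀ w ∈ X.C, X.p v (r + 1) - X.p w (r + 1) ≤ e) (hs0 : 0 ≤ s)
    (hs : ∀ v ∈ X.C, ∀ w ∈ X.C, X.rate v r - X.rate w r ≤ s) :
    ∀ v ∈ X.C, ∀ w ∈ X.C, X.p v (r + 2) - X.p w (r + 2) ≤
      (1 / 2 + (P.ϑbar - 1)) * e + (1 + P.ϑ) * P.U + P.T * (s + 4 * (P.ϑ ^ 2 * P.ν * P.T)) := by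
  intro v hv w hw
  have hS := hX.synced hP r
  have hc : ∀ u : Fin P.n, ∃ c : ℝ, u ∈ X.C → c ∈ Set.Ioo (X.p u (r + 1)) (X.p u (r + 2)) ∧
      X.p u (r + 2) = X.p u (r + 1) + (P.T + X.Δ u r) / (X.μ u (r + 1) * X.h u c) := by
    intro u
    by_cases hu : u ∈ X.C
    · obtain ⟨c, h⟩ := hX.exists_round_rate hP hu r
      exact ⟨c, fun _ => h⟩
    · exact ⟨0, fun h => absurd h hu⟩
  choose c hc using hc
  have hρ : ∀ u ∈ X.C, 1 ≤ X.μ u (r + 1) * X.h u (c u) ∧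
      X.μ u (r + 1) * X.h u (c u) ≤ P.ϑbar := fun u hu =>
    hX.scaled_rate_mem hP hu (r + 1) ((hX.p_nonneg u hu r).trans (hc u hu).1.1.le)
  have hρR : ∀ u ∈ X.C, |X.μ u (r + 1) * X.h u (c u) - X.rate u r| ≤
      P.ϑ ^ 2 * P.ν * (2 * P.T) := by
    intro u hu
    have h1 := (hc u hu).1
    have h2 := hX.p_succ_sub_le hP hu hS
    exact hX.scaled_rate_sub_le hP hu (r + 1) (hX.p_nonneg u hu r)
      ((hX.p_nonneg u hu r).trans h1.1.le)
      (abs_le.mpr ⟨by linarith [h1.1, hP.T_pos], by linarith [h1.2]⟩)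
  have h := hX.skew_succ_le hP hS he hρ (fun u hu => (hc u hu).2)
    (σ := P.T * (s + 4 * (P.ϑ ^ 2 * P.ν * P.T))) (fun v hv w hw => ?_) v hv w hw
  · refine h.trans ?_
    have h1 := mul_le_mul_of_nonneg_right hP.contraction_le
      (by linarith [he v hv v hv] : 0 ≤ e)
    linarith
  · have hv1 := hρ v hv
    have hw1 := hρ w hw
    have hv2 := abs_le.mp (hρR v hv)
    have hw2 := abs_le.mp (hρR w hw)
    have hvw := hs w hw v hv
    generalize X.μ v (r + 1) * X.h v (c v) = x at *
    generalize X.μ w (r + 1) * X.h w (c w) = y at *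
    have hx : 0 < x := by linarith
    have hy : 0 < y := by linarith
    have hB : 0 ≤ s + 4 * (P.ϑ ^ 2 * P.ν * P.T) :=
      add_nonneg hs0 (mul_nonneg (by norm_num)
        (mul_nonneg (mul_nonneg (by positivity) hP.nu_pos.le) hP.T_pos.le))
    have hyx : y - x ≤ s + 4 * (P.ϑ ^ 2 * P.ν * P.T) := by linarith
    rw [show P.T / x - P.T / y = P.T * ((y - x) / (x * y)) by field_simp]
    refine mul_le_mul_of_nonneg_left ?_ hP.T_pos.le
    rw [div_le_iff₀ (mul_pos hx hy)]
    exact hyx.trans (le_mul_of_one_le_right hB (one_le_mul_of_one_le_of_one_le hv1.1 hw1.1))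

theorem freq_estimate (hX : X.IsExecution) (hP : P.Admissible) (hv : v ∈ X.C) (hw : w ∈ X.C)
    (r : ℕ) :
    ∃ x : ℝ, X.freqEntry v r w = x ∧ |x - (X.rate w r - X.rate v r)| ≤
      P.ϑbar * P.U / (P.τ₂ + P.τ₃) + (P.ϑbar - 1) ^ 2 + 2 * P.ϑ ^ 2 * P.ν * P.T := by
  have hS := hX.synced hP r
  have hτ : 0 < P.τ₂ + P.τ₃ := add_pos hP.τ₂_pos hP.τ₃_pos
  refine ⟨_, by rw [freqEntry, if_pos (hX.freqHeard_nonempty hP hv hw hS),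
    if_pos (hX.phaseHeard_nonempty hP hv hw hS)], ?_⟩
  rw [hX.phaseStamp_eq hP hv hw hS, hX.freqStamp_eq hP hv hw hS]
  have ha := hX.phase_delay w hw v hv r
  have hb := hX.freq_delay w hw v hv r
  have hpw := hX.p_nonneg w hw r
  have hpv := hX.p_nonneg v hv r
  have ha0 := hX.a_nonneg hP hv hw (r := r)
  have hq := hX.p_le_q hw hP r
  have hT := hP.T_ge
  have hpos1 := hP.τ₁_pos
  have hpos2 := hP.τ₂_pos
  have hpos3 := hP.τ₃_pos
  have he := hP.e₁_pos
  have hsk := hS.skew_le w hw v hv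
  have hsk' := hS.skew_le v hv w hw
  have hedT : P.e₁ + P.d ≤ P.τ₄ := (hP.le_ϑbar_mul (by linarith [hP.d_nonneg])).trans hP.τ₄_ge'
  have hab : X.a w v (r + 1) < X.b w v (r + 1) := by
    linarith [hX.p_add_τ₂_lt_b hP hv hw hS, hP.τ₂_ge, ha.2]
  obtain ⟨c, hc, hcH⟩ := hX.exists_rate hv ha0 hab
  obtain ⟨c', hc', hcq⟩ := hX.exists_elapsed hw hpw (hX.q_nonneg w hw r)
    (hX.μ_mem hw hP.one_lt (r + 1)).1 hτ (hX.freq_pulse' hw r)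
  rw [hcH, show X.μ v (r + 1) * (X.h v c * (X.b w v (r + 1) - X.a w v (r + 1))) =
    X.μ v (r + 1) * X.h v c * (X.b w v (r + 1) - X.a w v (r + 1)) by ring]
  have hc0 : 0 ≤ c := ha0.trans hc.1.le
  have hc0' : 0 ≤ c' := hpw.trans hc'.1.le
  have hx := hX.scaled_rate_mem hP hv (r + 1) hc0
  have hy := hX.scaled_rate_mem hP hw (r + 1) hc0'
  have hxR : |X.μ v (r + 1) * X.h v c - X.rate v r| ≤ P.ϑ ^ 2 * P.ν * P.T := by
    refine hX.scaled_rate_sub_le hP hv (r + 1) hpv hc0 (abs_le.mpr ⟨?_, ?_⟩)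
    · linarith [hc.1, ha.1, hP.U_le, hP.window_pos, hP.d_nonneg]
    · linarith [hc.2, hb.2, hP.window_pos]
  have hyR : |X.μ w (r + 1) * X.h w c' - X.rate w r| ≤ P.ϑ ^ 2 * P.ν * P.T := by
    refine hX.scaled_rate_sub_le hP hw (r + 1) hpw hc0' (abs_le.mpr ⟨?_, ?_⟩)
    · linarith [hc'.1, hP.T_pos]
    · linarith [hc'.2, hP.window_pos, hP.τ₄_pos]
  set x := X.μ v (r + 1) * X.h v c
  set y := X.μ w (r + 1) * X.h w c'
  set ζ := X.b w v (r + 1) - X.a w v (r + 1) - (X.q w (r + 1) - X.p w (r + 1)) with hζ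
  have hζU : |ζ| ≤ P.U := abs_le.mpr ⟨by linarith [hb.1, ha.2], by linarith [hb.2, ha.1]⟩
  have hy0 : 0 < y := by linarith [hy.1]
  -- The three errors are: uncertainty `ζ` of the two delays; replacing the relative offset `(y -
  -- x)/y` by `y - x`, which is of second order; and the drift of both rates since the pulses.
  have hdec : 1 - x * (X.b w v (r + 1) - X.a w v (r + 1)) / (P.τ₂ + P.τ₃) -
      (X.rate w r - X.rate v r) =
      -(x * ζ / (P.τ₂ + P.τ₃)) + (y - x) * (1 / y - 1) + ((y - X.rate w r) - (x - X.rate v r)) := by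
    have : X.b w v (r + 1) - X.a w v (r + 1) = ζ + (P.τ₂ + P.τ₃) / y := by
      rw [hζ, hcq]
      ring
    rw [this]
    field_simp
    ring
  have h1 : |x * ζ / (P.τ₂ + P.τ₃)| ≤ P.ϑbar * P.U / (P.τ₂ + P.τ₃) := by
    rw [abs_div, abs_mul, abs_of_pos hτ, abs_of_nonneg (by linarith [hx.1] : 0 ≤ x)]
    exact div_le_div_of_nonneg_right
      (mul_le_mul hx.2 hζU (abs_nonneg _) (by linarith [hP.ϑbar_gt])) hτ.le
  have h2 : |(y - x) * (1 / y - 1)| ≤ (P.ϑbar - 1) ^ 2 := by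
    rw [abs_mul, sq]
    refine mul_le_mul (abs_le.mpr ⟨by linarith, by linarith⟩) ?_ (abs_nonneg _)
      (by linarith [hP.ϑbar_gt])
    have h3 : 1 / y ≤ 1 := (div_le_one hy0).mpr hy.1
    have h4 : 1 / P.ϑbar ≤ 1 / y := one_div_le_one_div_of_le hy0 hy.2
    exact abs_le.mpr ⟨by linarith [hP.one_sub_inv_le], by linarith [hP.ϑbar_gt]⟩
  rw [hdec]
  rw [abs_le] at *
  constructor <;> linarith

theorem exists_freq_bounds (hX : X.IsExecution) (hP : P.Admissible) (r : ℕ)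
    (hne : X.C.Nonempty) {s N : ℝ}
    (hN : P.ϑbar * P.U / (P.τ₂ + P.τ₃) + (P.ϑbar - 1) ^ 2 + 2 * P.ϑ ^ 2 * P.ν * P.T ≤ N)
    (hs : ∀ v ∈ X.C, ∀ w ∈ X.C, X.rate v r - X.rate w r ≤ s) :
    ∃ lo m hi, hi - lo ≤ s ∧ lo ≤ m ∧ m ≤ hi ∧ (∃ w ∈ X.C, X.rate w r = lo) ∧
      (∃ w ∈ X.C, X.rate w r = hi) ∧
      ∀ w ∈ X.C, (lo ≤ X.rate w r ∧ X.rate w r ≤ hi) ∧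
        (lo + m) / 2 - N ≤ X.ξ w r + X.rate w r ∧ X.ξ w r + X.rate w r ≤ (m + hi) / 2 + N := by
  obtain ⟨j, hj, hmin⟩ := X.C.exists_min_image (fun v => X.rate v r) hne
  obtain ⟨k, hk, hmax⟩ := X.C.exists_max_image (fun v => X.rate v r) hne
  have hy : ∀ w ∈ X.C, X.rate j r ≤ X.rate w r ∧ X.rate w r ≤ X.rate k r :=
    fun w hw => ⟨hmin w hw, hmax w hw⟩
  obtain ⟨i, hiC, h⟩ := exists_agreementMidpoint_bounds (SyncParams.three_mul_f_lt j.pos) X.C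
    hX.card_le fun w => X.rate w r
  refine ⟨X.rate j r, X.rate i r, X.rate k r, hs k hk j hj, (hy i hiC).1, (hy i hiC).2,
    ⟨j, hj, rfl⟩, ⟨k, hk, rfl⟩, fun w hw => ⟨hy w hw,
      h (X.freqEntry w r) (X.rate w r) N _ _ hy fun u hu => ?_⟩⟩
  obtain ⟨x, hx, hx'⟩ := hX.freq_estimate hP hw hu r
  exact ⟨x, hx, hx'.trans hN⟩

end IsExecution

end SyncRun

/-! ### Agreement on clock rates under pull-back and clamping. -/

/-- Effect of pulling a multiplier back towards `θ` and clamping it to `[1, θ²]`, seen at the clock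
rate `μ' * h`. -/
theorem exists_unclamped_rate {θ h μ μ' ε γ A lo c₁ c₂ hi : ℝ} (hθ : 1 < θ) (hh : 1 ≤ h)
    (hh' : h ≤ θ) (hγ : 0 ≤ γ) (hx : c₁ - A ≤ μ * h) (hx' : μ * h ≤ c₂ + A) (hlo : lo ≤ c₁)
    (hhi : c₂ ≤ hi) (hlo' : θ - 3 * γ ≤ lo) (hhi' : hi ≤ θ ^ 2 + 3 * γ) (hA : A ≤ 2 * γ)
    (hε : 2 * γ ≤ ε) (hε' : θ * ε ≤ 3 * γ) (hε₁ : ε ≤ 1)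
    (hμ' : μ' = if μ ≤ θ then max 1 (min (θ ^ 2) (μ + ε)) else max 1 (min (θ ^ 2) (μ - ε))) :
    ∃ u, c₁ - A - θ * ε ≤ u ∧ u ≤ c₂ + A + θ * ε ∧ μ' * h ≤ max θ u ∧ min (θ ^ 2) u ≤ μ' * h ∧
      θ - 3 * γ ≤ μ' * h ∧ μ' * h ≤ θ ^ 2 + 3 * γ := by
  have hh0 : 0 ≤ h := by linarith
  have hε0 : 0 ≤ ε := by linarith
  have hεh : ε ≤ ε * h := le_mul_of_one_le_right hε0 hh
  have hεh' : ε * h ≤ θ * ε := by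
    rw [mul_comm θ]
    exact mul_le_mul_of_nonneg_left hh' hε0
  have hεθ : ε ≤ θ * ε := le_mul_of_one_le_left hε0 hθ.le
  have hθ2 : θ ≤ θ ^ 2 := by nlinarith
  have hθh : θ ^ 2 ≤ θ ^ 2 * h := le_mul_of_one_le_right (by positivity) hh
  -- Raising a multiplier to `1` gives a rate `h ≤ θ`; cutting it to `θ²` gives a rate of at least
  -- `θ²`.
  have upper : ∀ m : ℝ, max 1 (min (θ ^ 2) m) * h ≤ max θ (m * h) := by
    intro m
    rw [max_mul_of_nonneg _ _ hh0, one_mul, min_mul_of_nonneg _ _ hh0]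
    exact max_le_max hh' (min_le_right _ _)
  have lower : ∀ m : ℝ, min (θ ^ 2) (m * h) ≤ max 1 (min (θ ^ 2) m) * h := by
    intro m
    refine le_trans ?_ (mul_le_mul_of_nonneg_right (le_max_right _ _) hh0)
    rw [min_mul_of_nonneg _ _ hh0]
    exact min_le_min_right _ hθh
  split_ifs at hμ' with hc
  -- Pulling up by `ε ≥ A` offsets the error below, and above `(θ + ε) θ ≤ θ² + 3γ`. The other case
  -- is dual.
  · refine ⟨(μ + ε) * h, by linarith, by linarith, hμ' ▸ upper _, hμ' ▸ lower _, ?_, ?_⟩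
    · rw [hμ']
      refine le_trans (le_min ?_ ?_) (lower _) <;> linarith
    · have h1 : μ' ≤ θ + ε := by
        rw [hμ']
        exact max_le (by linarith) ((min_le_right _ _).trans (by linarith))
      have h2 := mul_le_mul h1 hh' hh0 (by linarith)
      linarith
  · push Not at hc
    refine ⟨(μ - ε) * h, by linarith, by linarith, hμ' ▸ upper _, hμ' ▸ lower _, ?_, ?_⟩
    · have h1 : θ - ε ≤ μ' := by
        rw [hμ']
        exact le_max_of_le_right (le_min (by linarith) (by linarith))
      have h2 := mul_le_mul h1 hh (by norm_num) (by linarith)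
      linarith
    · rw [hμ']
      refine (upper _).trans (max_le ?_ ?_) <;> linarith

namespace SyncRun.IsExecution

variable {P : SyncParams} {X : SyncRun P}

theorem rate_mem' (hX : X.IsExecution) (hP : P.Admissible) {v : Fin P.n} (hv : v ∈ X.C) (r : ℕ) :
    1 ≤ X.rate v r ∧ X.rate v r ≤ P.ϑbar :=
  hX.scaled_rate_mem hP hv (r + 1) (hX.p_nonneg v hv r)

theorem rate_zero_mem (hX : X.IsExecution) (hP : P.Admissible) {v : Fin P.n} (hv : v ∈ X.C) :
    P.ϑ ≤ X.rate v 0 ∧ X.rate v 0 ≤ P.ϑ ^ 2 := by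
  obtain ⟨h1, h2⟩ := hX.rate_mem v hv _ (hX.p_nonneg v hv 0)
  have hθ := hP.one_lt
  rw [rate, hX.μ_one v hv]
  constructor <;> nlinarith

/-- Seen at rate `h`, the correction `2ξ/(ϑ + 1)` is nearly `ξ`, since `2h/(ϑ + 1)` is within `ϑ̄ -
1` of `1`. The term `6νT` is drift over a round of length at most `2T`, with `|μ̂| ≤ 3`. -/
theorem μhat_mul_sub_le (hX : X.IsExecution) (hP : P.Admissible)
    {v : Fin P.n} (hv : v ∈ X.C) (r : ℕ) {N A : ℝ} (hN0 : 0 ≤ N)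
    (hξ : |X.ξ v r| ≤ P.ϑbar - 1 + N)
    (hA : N + (P.ϑbar - 1) * (P.ϑbar - 1 + N) + 6 * (P.ν * P.T) ≤ A) (hA1 : A ≤ 1 / 2) :
    |X.μhat v r * X.h v (X.p v (r + 2)) - (X.ξ v r + X.rate v r)| ≤ A - N := by
  have hθ := hP.one_lt
  have hp := hX.p_nonneg v hv r
  have hp' := hX.p_nonneg v hv (r + 1)
  obtain ⟨h1, h2⟩ := hX.rate_mem v hv _ hp
  have hR := hX.rate_mem' hP hv r
  have hδ := hP.ϑbar_gt
  have hδ' := hP.ϑbar_lt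
  have hνT : 0 ≤ P.ν * P.T := mul_nonneg hP.nu_pos.le hP.T_pos.le
  have hpos : 0 < P.ϑ + 1 := by linarith
  have hprod : 0 ≤ (P.ϑbar - 1) * (P.ϑbar - 1 + N) := mul_nonneg (by linarith) (by linarith)
  have hfac : |2 * X.h v (X.p v (r + 1)) / (P.ϑ + 1) - 1| ≤ P.ϑbar - 1 := by
    have hs := SyncParams.sub_one_le_ϑbar hθ
    rw [abs_le]
    constructor
    · rw [le_sub_iff_add_le, le_div_iff₀ hpos]
      nlinarith
    · rw [sub_le_iff_le_add, div_le_iff₀ hpos]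
      nlinarith
  have hdec : X.μhat v r * X.h v (X.p v (r + 1)) - (X.ξ v r + X.rate v r) =
      (2 * X.h v (X.p v (r + 1)) / (P.ϑ + 1) - 1) * X.ξ v r := by
    rw [μhat, rate]
    field_simp
    ring
  have h3 : |X.μhat v r * X.h v (X.p v (r + 1)) - (X.ξ v r + X.rate v r)| ≤
      (P.ϑbar - 1) * (P.ϑbar - 1 + N) := by
    rw [hdec, abs_mul]
    exact mul_le_mul hfac hξ (abs_nonneg _) (by linarith)
  have hμ : |X.μhat v r| ≤ 3 := by
    have h4 : |X.μhat v r| ≤ |X.μhat v r * X.h v (X.p v (r + 1))| := by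
      rw [abs_mul]
      exact le_mul_of_one_le_right (abs_nonneg _) (h1.trans (le_abs_self _))
    refine h4.trans ?_
    rw [abs_le] at h3 hξ ⊢
    constructor <;> linarith
  have h5 : |X.μhat v r * X.h v (X.p v (r + 2)) - X.μhat v r * X.h v (X.p v (r + 1))| ≤
      3 * (P.ν * (2 * P.T)) := by
    rw [← mul_sub, abs_mul]
    refine mul_le_mul hμ ((hX.rate_lipschitz v hv _ _ hp hp').trans
      (mul_le_mul_of_nonneg_left ?_ hP.nu_pos.le)) (abs_nonneg _) (by norm_num)
    rw [abs_of_nonneg (by linarith [hX.p_add_U_le hv hP r, hP.U_nonneg])]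
    exact hX.p_succ_sub_le hP hv (hX.synced hP r)
  rw [abs_le] at *
  constructor <;> linarith

/-- One step of agreement on clock rates. The pull towards `ϑ` keeps all rates within
`[ϑ - 3γ, ϑ² + 3γ]`, hence clamping multipliers does not interfere with convergence. -/
theorem rate_succ (hX : X.IsExecution) (hP : P.Admissible) {γ N A s : ℝ} (r : ℕ) (hγ : 0 ≤ γ)
    (hN : P.ϑbar * P.U / (P.τ₂ + P.τ₃) + (P.ϑbar - 1) ^ 2 + 2 * P.ϑ ^ 2 * P.ν * P.T ≤ N)
    (hA : N + (P.ϑbar - 1) * (P.ϑbar - 1 + N) + 6 * (P.ν * P.T) ≤ A) (hA1 : A ≤ 1 / 2)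
    (hAγ : A ≤ 2 * γ) (hε : 2 * γ ≤ P.ε) (hε' : P.ϑ * P.ε ≤ 3 * γ) (hε₁ : P.ε ≤ 1)
    (hinv : ∀ v ∈ X.C, P.ϑ - 3 * γ ≤ X.rate v r ∧ X.rate v r ≤ P.ϑ ^ 2 + 3 * γ)
    (hs0 : 0 ≤ s) (hs : ∀ v ∈ X.C, ∀ w ∈ X.C, X.rate v r - X.rate w r ≤ s) :
    (∀ v ∈ X.C, P.ϑ - 3 * γ ≤ X.rate v (r + 1) ∧ X.rate v (r + 1) ≤ P.ϑ ^ 2 + 3 * γ) ∧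
      ∀ v ∈ X.C, ∀ w ∈ X.C,
        X.rate v (r + 1) - X.rate w (r + 1) ≤ s / 2 + 2 * (A + P.ϑ * P.ε) := by
  rcases X.C.eq_empty_or_nonempty with hne | hne
  · simp [hne]
  have hN0 := hP.freq_error_nonneg.trans hN
  have hθ := hP.one_lt
  obtain ⟨lo, m, hi, h1, h2, h3, ⟨j, hj, hjlo⟩, ⟨k, hk, hkhi⟩, h⟩ :=
    hX.exists_freq_bounds hP r hne hN hs
  have hlo := hX.rate_mem' hP hj r
  have hhi := hX.rate_mem' hP hk r
  rw [hjlo] at hlo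
  rw [hkhi] at hhi
  have key : ∀ v ∈ X.C, ∃ u, (lo + m) / 2 - A - P.ϑ * P.ε ≤ u ∧
      u ≤ (m + hi) / 2 + A + P.ϑ * P.ε ∧ X.rate v (r + 1) ≤ max P.ϑ u ∧
      min (P.ϑ ^ 2) u ≤ X.rate v (r + 1) ∧ P.ϑ - 3 * γ ≤ X.rate v (r + 1) ∧
      X.rate v (r + 1) ≤ P.ϑ ^ 2 + 3 * γ := by
    intro v hv
    obtain ⟨⟨v1, v2⟩, v3, v4⟩ := h v hv
    obtain ⟨r1, r2⟩ := hX.rate_mem v hv _ (hX.p_nonneg v hv (r + 1))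
    have hξ : |X.ξ v r| ≤ P.ϑbar - 1 + N := abs_le.mpr ⟨by linarith, by linarith⟩
    obtain ⟨x1, x2⟩ := abs_le.mp (hX.μhat_mul_sub_le hP hv r hN0 hξ hA hA1)
    exact exists_unclamped_rate hθ r1 r2 hγ (lo := lo) (hi := hi) (μ := X.μhat v r) (A := A)
      (by linarith) (by linarith) (by linarith) (by linarith)
      (hjlo ▸ (hinv j hj).1) (hkhi ▸ (hinv k hk).2) hAγ hε hε' hε₁ (hX.μ_step v hv r)
  have hεθ : P.ε ≤ P.ϑ * P.ε := le_mul_of_one_le_left (by linarith) hθ.le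
  have hνT : 0 ≤ P.ν * P.T := mul_nonneg hP.nu_pos.le hP.T_pos.le
  have hprod : 0 ≤ (P.ϑbar - 1) * (P.ϑbar - 1 + N) :=
    mul_nonneg (by linarith [hP.ϑbar_gt]) (by linarith [hP.ϑbar_gt])
  refine ⟨fun v hv => ?_, fun v hv w hw => ?_⟩
  · obtain ⟨u, -, -, -, -, h4, h5⟩ := key v hv
    exact ⟨h4, h5⟩
  · obtain ⟨u, u1, u2, u3, u4, u5, u6⟩ := key v hv
    obtain ⟨z, z1, z2, z3, z4, z5, z6⟩ := key w hw
    -- A rate affected by clamping from below is at most `ϑ`, while all others are at least `ϑ -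
    -- 3γ`, and `3γ ≤ 2ϑε`. The same holds at `ϑ²`. Unclamped rates contract by agreement.
    rcases le_max_iff.mp u3 with hu | hu
    · linarith
    · rcases min_le_iff.mp z4 with hz | hz <;> linarith

/-- Bounds on the spread of clock rates over the rounds. -/
theorem rate_spread (hX : X.IsExecution) (hP : P.Admissible) {γ N A : ℝ} (hγ : 0 ≤ γ)
    (hN : P.ϑbar * P.U / (P.τ₂ + P.τ₃) + (P.ϑbar - 1) ^ 2 + 2 * P.ϑ ^ 2 * P.ν * P.T ≤ N)
    (hA : N + (P.ϑbar - 1) * (P.ϑbar - 1 + N) + 6 * (P.ν * P.T) ≤ A) (hA1 : A ≤ 1 / 2)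
    (hAγ : A ≤ 2 * γ) (hε : 2 * γ ≤ P.ε) (hε' : P.ϑ * P.ε ≤ 3 * γ) (hε₁ : P.ε ≤ 1)
    {S : ℕ → ℝ} (hS0 : P.ϑbar - 1 ≤ S 0)
    (hS : ∀ r, S r / 2 + 2 * (A + P.ϑ * P.ε) ≤ S (r + 1)) (hSnn : ∀ r, 0 ≤ S r) (r : ℕ) :
    (∀ v ∈ X.C, P.ϑ - 3 * γ ≤ X.rate v r ∧ X.rate v r ≤ P.ϑ ^ 2 + 3 * γ) ∧
      ∀ v ∈ X.C, ∀ w ∈ X.C, X.rate v r - X.rate w r ≤ S r := by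
  induction r with
  | zero =>
    refine ⟨fun v hv => ?_, fun v hv w hw => ?_⟩
    · obtain ⟨h1, h2⟩ := hX.rate_zero_mem hP hv
      constructor <;> linarith
    · linarith [(hX.rate_mem' hP hv 0).2, (hX.rate_mem' hP hw 0).1]
  | succ r ih =>
    obtain ⟨h1, h2⟩ := hX.rate_succ hP r hγ hN hA hA1 hAγ hε hε' hε₁ ih.1 (hSnn r) ih.2
    exact ⟨h1, fun v hv w hw => (h2 v hv w hw).trans (hS r)⟩

theorem skew_bound (hX : X.IsExecution) (hP : P.Admissible) {E S : ℕ → ℝ}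
    (hSnn : ∀ r, 0 ≤ S r)
    (hS : ∀ r, ∀ v ∈ X.C, ∀ w ∈ X.C, X.rate v r - X.rate w r ≤ S r) (hE0 : P.e₁ ≤ E 0)
    (hE : ∀ r, (1 / 2 + (P.ϑbar - 1)) * E r +
      ((1 + P.ϑ) * P.U + P.T * (S r + 4 * (P.ϑ ^ 2 * P.ν * P.T))) ≤ E (r + 1)) (r : ℕ) :
    ∀ v ∈ X.C, ∀ w ∈ X.C, X.p v (r + 1) - X.p w (r + 1) ≤ E r := by
  induction r with
  | zero => exact fun v hv w hw => ((hX.synced hP 0).skew_le v hv w hw).trans hE0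
  | succ r ih =>
    intro v hv w hw
    have h1 := hX.skew_succ_le_of_rate hP r ih (hSnn r) (hS r) v hv w hw
    rw [add_assoc] at h1
    exact h1.trans (hE r)

end SyncRun.IsExecution

/-! ### The steady state near ideal parameters. -/

namespace SyncParams

/-- The smallest admissible value of `ε`. -/
noncomputable def leastPullBack (P : SyncParams) : ℝ :=
  (P.ϑ - 1) * (P.ϑ ^ 3 - 1) + 2 * P.ϑ ^ 3 * (1 - 1 / P.ϑ ^ 3) ^ 2
    + 2 * P.ϑ ^ 3 * P.U / (P.τ₂ + P.τ₃) + 2 * (P.ϑ ^ 3 + 1) * P.ν * P.T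

theorem FreqConstraints.eq_leastPullBack {P : SyncParams} (h : P.FreqConstraints)
    (hmin : P.MinimalPullBack) : P.ε = P.leastPullBack :=
  le_antisymm (hmin.2 (show FreqConstraints { P with ε := P.leastPullBack } from
    ⟨h.tau_one, h.tau_two, h.tau_three, h.tau_four, h.round_length, le_rfl⟩)) h.pull_back

/-- This is how `α ≈ 1/2` enters: it forces `ϑ̄ ≈ 1`. -/
theorem two_mul_le_α {P : SyncParams} (h : 1 < P.ϑ) : 2 * (P.ϑbar - 1) ≤ P.α - 1 / 2 := by
  have h1 := one_lt_ϑbar h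
  rw [α, le_sub_iff_add_le, le_div_iff₀ (by linarith)]
  nlinarith

/-- Estimates for the parameters near the steady state, in terms of `γ = U / T`. -/
theorem Admissible.small_parameters {P : SyncParams} (hP : P.Admissible) {κ γ : ℝ}
    (hκ0 : 0 < κ) (hκ : κ ≤ 1 / 100) (hγ : γ * P.T = P.U) (hα : |P.α - 1 / 2| ≤ κ)
    (hmin : P.MinimalPullBack) (hT : |P.T - P.τ₃| ≤ κ * P.T) (hτ : P.τ₂ ≤ κ * P.τ₃)
    (hmax : max ((P.ϑbar - 1) ^ 2 * P.T) (P.ν * P.T ^ 2) ≤ κ * P.U) :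
    0 < γ ∧ γ ≤ κ ∧ P.ϑbar - 1 ≤ κ / 2 ∧ (P.ϑbar - 1) ^ 2 ≤ κ * γ ∧ P.ν * P.T ≤ κ * γ ∧
      P.ϑbar * P.U / (P.τ₂ + P.τ₃) + (P.ϑbar - 1) ^ 2 + 2 * P.ϑ ^ 2 * P.ν * P.T ≤
        (1 + 7 * κ) * γ ∧
      2 * γ ≤ P.ε ∧ P.ϑ * P.ε ≤ (2 + 16 * κ) * γ := by
  have hT0 := hP.T_pos
  have hθ := hP.one_lt
  have hb1 := hP.ϑbar_gt
  have hθb := hP.ϑ_lt_ϑbar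
  have hδ : P.ϑbar - 1 ≤ κ / 2 := by linarith [two_mul_le_α hθ, (abs_le.mp hα).2]
  have hδ0 : 0 < P.ϑbar - 1 := by linarith
  have hτ0 : 0 < P.τ₂ + P.τ₃ := add_pos hP.τ₂_pos hP.τ₃_pos
  have hτT : P.τ₂ + P.τ₃ ≤ P.T := by
    linarith [hP.T_ge, hP.τ₁_pos, hP.τ₄_pos, hP.window_pos]
  have hτT' : (1 - κ) * P.T ≤ P.τ₂ + P.τ₃ := by linarith [(abs_le.mp hT).2, hP.τ₂_pos]
  have hU0 : 0 < P.U := by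
    have h1 : 0 < P.ν * P.T ^ 2 := mul_pos hP.nu_pos (by positivity)
    exact pos_of_mul_pos_right (h1.trans_le ((le_max_right _ _).trans hmax)) hκ0.le
  have hγ0 : 0 < γ := pos_of_mul_pos_left (hγ ▸ hU0) hT0.le
  -- `U ≤ d ≤ τ₂ ≤ κ τ₃ ≤ κ T`.
  have hγκ : γ ≤ κ := by
    refine le_of_mul_le_mul_right ?_ hT0
    rw [hγ]
    have h1 : κ * P.τ₃ ≤ κ * P.T := mul_le_mul_of_nonneg_left (by linarith [hP.τ₂_pos]) hκ0.le
    linarith [hP.U_le, hP.τ₂_ge, hP.e₁_pos]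
  have hκγ : 0 < κ * γ := mul_pos hκ0 hγ0
  have hδ2 : (P.ϑbar - 1) ^ 2 ≤ κ * γ := by
    refine le_of_mul_le_mul_right (((le_max_left _ _).trans hmax).trans_eq ?_) hT0
    rw [← hγ, mul_assoc]
  have hνT : P.ν * P.T ≤ κ * γ := by
    refine le_of_mul_le_mul_right (le_of_eq_of_le ?_ (((le_max_right _ _).trans hmax).trans_eq ?_))
      hT0
    · ring
    · rw [← hγ, mul_assoc]
  have hνT0 : 0 < P.ν * P.T := mul_pos hP.nu_pos hT0
  obtain ⟨g, hg⟩ : ∃ g, g = P.U / (P.τ₂ + P.τ₃) := ⟨_, rfl⟩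
  have hgγ : γ ≤ g := by
    rw [hg, le_div_iff₀ hτ0, ← hγ]
    exact mul_le_mul_of_nonneg_left hτT hγ0.le
  have hgγ' : g ≤ (1 + 2 * κ) * γ := by
    rw [hg, div_le_iff₀ hτ0, ← hγ]
    have h1 : γ * P.T ≤ (1 + 2 * κ) * γ * ((1 - κ) * P.T) := by
      have : 0 ≤ (κ * γ) * (1 - 2 * κ) * P.T :=
        mul_nonneg (mul_nonneg hκγ.le (by linarith)) hT0.le
      linarith
    exact h1.trans (mul_le_mul_of_nonneg_left hτT' (mul_nonneg (by linarith) hγ0.le))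
  have hκ2 : κ * (κ * γ) ≤ 1 / 100 * (κ * γ) := mul_le_mul_of_nonneg_right hκ hκγ.le
  have hbg : P.ϑbar * g ≤ (1 + 3 * κ) * γ := by
    have h1 : P.ϑbar * g ≤ (1 + κ / 2) * ((1 + 2 * κ) * γ) :=
      mul_le_mul (by linarith) hgγ' (by linarith) (by linarith)
    linarith
  have hbg' : γ ≤ P.ϑbar * g := hgγ.trans (le_mul_of_one_le_left (by linarith) hb1.le)
  have hθ2 : P.ϑ ^ 2 ≤ P.ϑbar := pow_le_pow_right₀ hθ.le (by norm_num)
  have hθ2ν : P.ϑ ^ 2 * (P.ν * P.T) ≤ 3 / 2 * (κ * γ) :=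
    mul_le_mul (by linarith) hνT hνT0.le (by norm_num)
  have e1 : (P.ϑ - 1) * (P.ϑbar - 1) ≤ κ * γ := by
    refine le_trans ?_ hδ2
    rw [sq]
    exact mul_le_mul_of_nonneg_right (by linarith) hδ0.le
  have e1' : 0 ≤ (P.ϑ - 1) * (P.ϑbar - 1) := mul_nonneg (by linarith) hδ0.le
  have e2 : P.ϑbar * (1 - 1 / P.ϑbar) ^ 2 ≤ κ * γ := by
    have h1 : P.ϑbar * (1 - 1 / P.ϑbar) ^ 2 = (P.ϑbar - 1) ^ 2 / P.ϑbar := by field_simp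
    rw [h1]
    exact (div_le_self (sq_nonneg _) hb1.le).trans hδ2
  have e2' : 0 ≤ P.ϑbar * (1 - 1 / P.ϑbar) ^ 2 := mul_nonneg (by linarith) (sq_nonneg _)
  have e3 : (P.ϑbar + 1) * (P.ν * P.T) ≤ 201 / 100 * (κ * γ) :=
    mul_le_mul (by linarith) hνT hνT0.le (by norm_num)
  have e3' : 0 ≤ (P.ϑbar + 1) * (P.ν * P.T) := mul_nonneg (by linarith) hνT0.le
  -- The delay term `2 ϑ̄ g ≈ 2γ` dominates; all others are `O(κ γ)`.
  have hε : P.ε = (P.ϑ - 1) * (P.ϑbar - 1) + 2 * (P.ϑbar * (1 - 1 / P.ϑbar) ^ 2) +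
      2 * (P.ϑbar * g) + 2 * ((P.ϑbar + 1) * (P.ν * P.T)) := by
    rw [hP.constraints.eq_leastPullBack hmin, leastPullBack, hg, ϑbar]
    ring
  refine ⟨hγ0, hγκ, hδ, hδ2, hνT, ?_, by linarith, ?_⟩
  · rw [mul_div_assoc, ← hg]
    linarith
  · have h1 : P.ε ≤ (2 + 14 * κ) * γ := by linarith
    have h2 : P.ϑ * P.ε ≤ (1 + κ / 2) * ((2 + 14 * κ) * γ) :=
      mul_le_mul (by linarith) h1 (by linarith) (by linarith)
    linarith

/-- Executions of systems with nearly ideal parameters synchronize uniformly well after finitely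
many rounds. -/
theorem Admissible.eventually_skew_le {P : SyncParams} (hP : P.Admissible) {η κ : ℝ} (hη : 0 < η)
    (hκ0 : 0 < κ) (hκ : κ ≤ 1 / 100) (hκη : 700 * κ ≤ η) (hα : |P.α - 1 / 2| ≤ κ)
    (hmin : P.MinimalPullBack) (hT : |P.T - P.τ₃| ≤ κ * P.T) (hτ : P.τ₂ ≤ κ * P.τ₃)
    (hmax : max ((P.ϑbar - 1) ^ 2 * P.T) (P.ν * P.T ^ 2) ≤ κ * P.U) :
    ∀ᶠ r in Filter.atTop, ∀ X : SyncRun P, X.IsExecution → ∀ v ∈ X.C, ∀ w ∈ X.C,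
      X.p v (r + 1) - X.p w (r + 1) ≤ (28 + η) * P.U := by
  have hT0 := hP.T_pos
  obtain ⟨γ, hγ⟩ : ∃ γ, γ * P.T = P.U := ⟨P.U / P.T, div_mul_cancel₀ _ hT0.ne'⟩
  obtain ⟨hγ0, hγκ, hδ, hδ2, hνT, hN, hε, hε'⟩ :=
    hP.small_parameters hκ0 hκ hγ hα hmin hT hτ hmax
  have hU0 : 0 < P.U := hγ ▸ mul_pos hγ0 hT0
  have hθ := hP.one_lt
  have hb1 := hP.ϑbar_gt
  have hθb := hP.ϑ_lt_ϑbar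
  have hκγ : 0 < κ * γ := mul_pos hκ0 hγ0
  have hκγ' : κ * γ ≤ 1 / 100 * γ := mul_le_mul_of_nonneg_right hκ hγ0.le
  have hεθ : P.ε ≤ P.ϑ * P.ε := le_mul_of_one_le_left (by linarith) hθ.le
  have hA : (1 + 7 * κ) * γ + (P.ϑbar - 1) * (P.ϑbar - 1 + (1 + 7 * κ) * γ) + 6 * (P.ν * P.T) ≤
      (1 + 15 * κ) * γ := by
    have h1 : (P.ϑbar - 1) * ((1 + 7 * κ) * γ) ≤ κ / 2 * (2 * γ) :=
      mul_le_mul hδ (by linarith) (by positivity) (by positivity)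
    linarith
  have hθ2 : P.ϑ ^ 2 ≤ P.ϑbar := pow_le_pow_right₀ hθ.le (by norm_num)
  have hdrift : P.ϑ ^ 2 * P.ν * P.T ≤ 3 / 2 * (κ * γ) := by
    rw [mul_assoc]
    exact mul_le_mul (by linarith) hνT (mul_pos hP.nu_pos hT0).le (by norm_num)
  have hdrift0 : 0 ≤ P.ϑ ^ 2 * P.ν * P.T :=
    mul_nonneg (mul_nonneg (by positivity) hP.nu_pos.le) hT0.le
  -- The constant is `4((1 + 15κ) + (2 + 16κ)) γ`, the fixed point of `s ↦ s/2 + 2(A + ϑ ε)` at the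
  -- bounds for `A` and `ϑ ε`; the rest is the decaying initial spread.
  let S : ℕ → ℝ := fun r => (12 + 124 * κ) * γ + (P.ϑbar - 1) * (1 / 2) ^ r
  have hS : ∀ X : SyncRun P, X.IsExecution → ∀ r, ∀ v ∈ X.C, ∀ w ∈ X.C,
      X.rate v r - X.rate w r ≤ S r := by
    intro X hX r
    refine (hX.rate_spread hP (S := S) hγ0.le hN hA (by linarith) (by linarith) hε (by linarith)
      (by linarith) ?_ (fun r => ?_) (fun r => ?_) r).2
    · simp only [S, pow_zero, mul_one]
      linarith
    · simp only [S, pow_succ]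
      linarith
    · have := mul_nonneg (by linarith : 0 ≤ P.ϑbar - 1) (by positivity : (0 : ℝ) ≤ (1 / 2) ^ r)
      simp only [S]
      linarith
  have hSnn : ∀ r, 0 ≤ S r := fun r => by
    have := mul_nonneg (by linarith : 0 ≤ P.ϑbar - 1) (by positivity : (0 : ℝ) ≤ (1 / 2) ^ r)
    simp only [S]
    linarith
  -- Large enough to absorb the transient of the rates: `11/20 + 1/5 = 3/4`.
  let M : ℝ := P.e₁ + 5 * (P.T * (P.ϑbar - 1))
  have hD : 0 ≤ P.T * (P.ϑbar - 1) := mul_nonneg hT0.le (by linarith)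
  have hM : 0 < M := by linarith [hP.e₁_pos]
  have hκU : 0 < κ * P.U := mul_pos hκ0 hU0
  -- `28` solves `x = x/2 + 2 + 12`; `350κ` covers the lower order terms and is at most `η / 2`.
  let E : ℕ → ℝ := fun r => (28 + 350 * κ) * P.U + M * (3 / 4) ^ r
  have hE : ∀ r, (1 / 2 + (P.ϑbar - 1)) * E r +
      ((1 + P.ϑ) * P.U + P.T * (S r + 4 * (P.ϑ ^ 2 * P.ν * P.T))) ≤ E (r + 1) := by
    intro r
    have h1 : P.T * ((P.ϑbar - 1) * (1 / 2) ^ r) ≤ P.T * (P.ϑbar - 1) * (3 / 4) ^ r := by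
      rw [← mul_assoc]
      exact mul_le_mul_of_nonneg_left (pow_le_pow_left₀ (by norm_num) (by norm_num) r) hD
    have h2 : P.T * ((12 + 124 * κ) * γ + 4 * (P.ϑ ^ 2 * P.ν * P.T)) ≤ (12 + 130 * κ) * P.U := by
      rw [← hγ, show (12 + 130 * κ) * (γ * P.T) = P.T * ((12 + 130 * κ) * γ) by ring]
      exact mul_le_mul_of_nonneg_left (by linarith) hT0.le
    have h3 : (1 + P.ϑ) * P.U ≤ (2 + κ) * P.U :=
      mul_le_mul_of_nonneg_right (by linarith) hU0.le
    have hpow : (0 : ℝ) ≤ (3 / 4) ^ r := by positivity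
    have h4 : (1 / 2 + (P.ϑbar - 1)) * (M * (3 / 4) ^ r) + P.T * (P.ϑbar - 1) * (3 / 4) ^ r ≤
        M * (3 / 4) ^ (r + 1) := by
      have h5 : (1 / 2 + (P.ϑbar - 1)) * M + P.T * (P.ϑbar - 1) ≤ 3 / 4 * M := by
        have h6 := mul_le_mul_of_nonneg_right (by linarith : 1 / 2 + (P.ϑbar - 1) ≤ 11 / 20) hM.le
        have h7 : 5 * (P.T * (P.ϑbar - 1)) ≤ M := le_add_of_nonneg_left hP.e₁_pos.le
        linarith
      have := mul_le_mul_of_nonneg_right h5 hpow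
      rw [pow_succ]
      linarith
    have h5 : (1 / 2 + (P.ϑbar - 1)) * ((28 + 350 * κ) * P.U) ≤
        (1 / 2 + κ / 2) * ((28 + 350 * κ) * P.U) :=
      mul_le_mul_of_nonneg_right (by linarith) (mul_nonneg (by linarith) hU0.le)
    have h6 : κ * (κ * P.U) ≤ 1 / 100 * (κ * P.U) := mul_le_mul_of_nonneg_right hκ hκU.le
    simp only [E, S]
    linarith
  have hE0 : P.e₁ ≤ E 0 := by
    have h1 : 0 ≤ (28 + 350 * κ) * P.U := mul_nonneg (by linarith) hU0.le
    simp only [E, M, pow_zero, mul_one]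
    linarith
  have hlim : Filter.Tendsto (fun r : ℕ => M * (3 / 4 : ℝ) ^ r) Filter.atTop (nhds (M * 0)) :=
    (tendsto_pow_atTop_nhds_zero_of_lt_one (by norm_num) (by norm_num)).const_mul M
  rw [mul_zero] at hlim
  filter_upwards [hlim.eventually (gt_mem_nhds (by positivity : 0 < η / 2 * P.U))] with r hr
  intro X hX v hv w hw
  have h1 := hX.skew_bound hP hSnn (hS X hX) hE0 hE r v hv w hw
  have h2 : 350 * κ * P.U ≤ η / 2 * P.U := mul_le_mul_of_nonneg_right (by linarith) hU0.le
  simp only [E] at h1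
  linarith

theorem steadyStateError_le {P : SyncParams} {B : ℝ}
    (h : ∀ᶠ r in Filter.atTop, ∀ X : SyncRun P, X.IsExecution → ∀ v ∈ X.C, ∀ w ∈ X.C,
      X.p v (r + 1) - X.p w (r + 1) ≤ B) : steadyStateError P ≤ (B : EReal) := by
  -- Executions constrain pulses only from index `1` on.
  rw [steadyStateError, ← Filter.limsup_nat_add _ 1]
  refine Filter.limsup_le_of_le (h := ?_)
  filter_upwards [h] with r hr
  refine iSup_le fun X => iSup₂_le fun v hv => iSup₂_le fun w hw => ?_
  exact EReal.coe_le_coe_iff.mpr (hr X.1 X.2 v hv w hw)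

/-! ### Feasibility of the parameters. -/

theorem minimalPullBack_of_eq {P : SyncParams} (h : P.FreqConstraints)
    (hε : P.ε = P.leastPullBack) : P.MinimalPullBack :=
  ⟨h, fun _ hx => hε.trans_le hx.pull_back⟩

theorem exists_feasible_choice {κ κ' : ℝ} (hκ' : κ' = min (1 / 12) (κ / 12)) {P : SyncParams}
    (hκ : 0 < κ) (hθ : 1 < P.ϑ) (hU0 : 0 ≤ P.U) (hUd : P.U ≤ P.d) (hT0 : 0 < P.T)
    (hα : P.αbar < 1) (hτ₁ : P.τ₁ = P.ϑbar * P.e₁)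
    (hT : P.ϑbar * (P.e₁ + P.d) ≤ κ' * P.T) :
    ∃ τ₂ τ₃ τ₄ ε : ℝ,
      (P.withChoice τ₂ τ₃ τ₄ ε).FreqConstraints ∧
      (P.withChoice τ₂ τ₃ τ₄ ε).MinimalPullBack ∧
      |P.T - τ₃| ≤ κ * P.T ∧ τ₂ ≤ κ * τ₃ := by
  have hb1 := one_lt_ϑbar hθ
  have hβ := βbar_ge hθ
  have hβ' := βbar_lt hθ hα
  obtain ⟨b, hb⟩ : ∃ b, b = P.ϑbar := ⟨_, rfl⟩
  rw [← hb] at hb1 hβ hτ₁ hT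
  have hb0 : 0 < b := by linarith
  -- From the second branch of `e₁`: drift over a whole round costs no more than `b e₁`.
  have hbT : (b - 1) * P.T ≤ b * P.e₁ := by
    have h1 : ((1 - 1 / b) * P.T + (3 * b - 1) * P.U) / (1 - P.βbar) ≤ P.e₁ := by
      rw [hb]
      exact le_max_right _ _
    rw [div_le_iff₀ (by linarith)] at h1
    have hu : 0 ≤ (3 * b - 1) * P.U := mul_nonneg (by linarith) hU0
    have ht : 0 ≤ (1 - 1 / b) * P.T :=
      mul_nonneg (sub_nonneg.mpr ((div_le_one hb0).mpr hb1.le)) hT0.le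
    have he0 : 0 ≤ P.e₁ := nonneg_of_mul_nonneg_left (by linarith : 0 ≤ P.e₁ * (1 - P.βbar))
      (by linarith)
    have h2 : P.e₁ * (1 - P.βbar) ≤ P.e₁ := mul_le_of_le_one_right he0 (by linarith)
    have h3 : b * ((1 - 1 / b) * P.T) ≤ b * P.e₁ :=
      mul_le_mul_of_nonneg_left (by linarith) hb0.le
    have h4 : b * ((1 - 1 / b) * P.T) = (b - 1) * P.T := by field_simp
    linarith
  have hbT0 : 0 ≤ (b - 1) * P.T := mul_nonneg (by linarith) hT0.le
  have hbd : 0 ≤ b * P.d := mul_nonneg hb0.le (by linarith)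
  have hbU : b * P.U ≤ b * P.d := mul_le_mul_of_nonneg_left hUd hb0.le
  have hbU0 : 0 ≤ b * P.U := mul_nonneg hb0.le hU0
  obtain ⟨m, hm⟩ : ∃ m, m = b * (P.e₁ + P.d) := ⟨_, rfl⟩
  rw [← hm] at hT
  have hbe : b * P.e₁ ≤ m := by linarith
  have hm0 : 0 ≤ m := by linarith
  have hκ1 : κ' * P.T ≤ 1 / 12 * P.T :=
    mul_le_mul_of_nonneg_right (hκ' ▸ min_le_left _ _) hT0.le
  have hκ2 : κ' * P.T ≤ κ / 12 * P.T :=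
    mul_le_mul_of_nonneg_right (hκ' ▸ min_le_right _ _) hT0.le
  have hbm : (b - 1) * m ≤ m := by
    have h1 : b - 1 ≤ 1 := le_of_mul_le_mul_right (by linarith : (b - 1) * P.T ≤ 1 * P.T) hT0
    exact mul_le_of_le_one_left hm0 h1
  have hbm0 : 0 ≤ (b - 1) * m := mul_nonneg (by linarith) hm0
  -- `t` is the value of `τ₃` for which the round length constraint holds with equality when `τ₂ =
  -- m` and `τ₄` is minimal. The choice leaves `e₁` unchanged.
  obtain ⟨t, ht⟩ : ∃ t, t = (P.T - (b * P.e₁ + 2 * m + (b - 1) * m + b * (P.e₁ + P.U))) / b :=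
    ⟨_, rfl⟩
  have hbt : b * t = P.T - (b * P.e₁ + 2 * m + (b - 1) * m + b * (P.e₁ + P.U)) := by
    rw [ht, mul_div_cancel₀ _ hb0.ne']
  have htT : t ≤ P.T := by
    refine le_of_mul_le_mul_left ?_ hb0
    rw [hbt]
    linarith
  have htT' : P.T - 6 * m ≤ t := by
    have h1 : (b - 1) * t ≤ (b - 1) * P.T := mul_le_mul_of_nonneg_left htT (by linarith)
    linarith
  let Q := P.withChoice m t (m + (b - 1) * (m + t)) 0
  have hmul : ∀ x, b * ((1 - 1 / b) * x) = (b - 1) * x := fun x => by field_simp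
  have hc : (P.withChoice m t (m + (b - 1) * (m + t)) Q.leastPullBack).FreqConstraints := by
    refine ⟨?_, ?_, ?_, ?_, ?_, le_rfl⟩
    · change P.ϑbar * P.e₁ ≤ P.τ₁
      rw [hτ₁, hb]
    · change P.ϑbar * (P.e₁ + P.d) ≤ m
      rw [hm, hb]
    · change P.ϑbar * (P.e₁ + (1 - 1 / P.ϑbar) * (P.τ₁ + m)) ≤ t
      rw [← hb, mul_add, hmul, hτ₁]
      have h1 : (b - 1) * (b * P.e₁ + m) ≤ (b - 1) * (2 * m) :=
        mul_le_mul_of_nonneg_left (by linarith) (by linarith)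
      linarith
    · change P.ϑbar * (P.e₁ + P.d + (1 - 1 / P.ϑbar) * (m + t)) ≤ m + (b - 1) * (m + t)
      rw [← hb, mul_add, hmul, ← hm]
    · change P.τ₁ + m + t + (m + (b - 1) * (m + t)) + P.ϑbar * (P.e₁ + P.U) ≤ P.T
      rw [← hb, hτ₁]
      linarith
  refine ⟨m, t, m + (b - 1) * (m + t), Q.leastPullBack, hc, minimalPullBack_of_eq hc rfl, ?_, ?_⟩
  · rw [abs_of_nonneg (by linarith)]
    have := mul_pos hκ hT0
    linarith
  · have h1 : κ * (P.T / 2) ≤ κ * t := mul_le_mul_of_nonneg_left (by linarith) hκ.le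
    have := mul_pos hκ hT0
    linarith

end SyncParams

theorem mainTheorem4 :
    (∀ η : ℝ, 0 < η → ∃ κ : ℝ, 0 < κ ∧
      ∀ P : SyncParams, 1 < P.ϑ → 0 < P.ν → 0 ≤ P.U → P.U ≤ P.d →
        P.FreqConstraints → P.αbar < 1 →
        |P.α - 1 / 2| ≤ κ →
        P.MinimalPullBack →
        |P.T - P.τ₃| ≤ κ * P.T → P.τ₂ ≤ κ * P.τ₃ →
        max ((P.ϑbar - 1) ^ 2 * P.T) (P.ν * P.T ^ 2) ≤ κ * P.U →
        steadyStateError P ≤ (((28 + η) * P.U : ℝ) : EReal)) ∧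
    (∀ κ : ℝ, 0 < κ → ∃ κ' : ℝ, 0 < κ' ∧
      ∀ P : SyncParams, 1 < P.ϑ → 0 < P.ν → 0 ≤ P.U → P.U ≤ P.d → 0 < P.F → 0 < P.T →
        P.αbar < 1 → P.τ₁ = P.ϑbar * P.e₁ →
        P.ϑbar * (P.e₁ + P.d) ≤ κ' * P.T →
        ∃ τ₂ τ₃ τ₄ ε : ℝ,
          (P.withChoice τ₂ τ₃ τ₄ ε).FreqConstraints ∧
          (P.withChoice τ₂ τ₃ τ₄ ε).MinimalPullBack ∧
          |P.T - τ₃| ≤ κ * P.T ∧ τ₂ ≤ κ * τ₃) := by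
  refine ⟨fun η hη => ⟨min (1 / 100) (η / 700), by positivity, ?_⟩,
    fun κ hκ => ⟨min (1 / 12) (κ / 12), by positivity, ?_⟩⟩
  · intro P hθ hν hU0 hUd hc hαbar hα hmin hT hτ hmax
    refine SyncParams.steadyStateError_le ?_
    by_cases hF : 0 < P.F
    · have hP : P.Admissible := ⟨hθ, hν, hU0, hUd, hc, hαbar, hF⟩
      refine hP.eventually_skew_le hη (by positivity) (min_le_left _ _) ?_ hα hmin hT hτ hmax
      linarith [min_le_right (1 / 100) (η / 700)]
    -- If `F ≤ 0`, the initial window `[0, F)` is empty and no node can be correct.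
    · exact Filter.Eventually.of_forall fun r X hX v hv => absurd (hX.F_pos hv) hF
  · intro P hθ _ hU0 hUd _ hT0 hα hτ₁ hT
    exact SyncParams.exists_feasible_choice rfl hκ hθ hU0 hUd hT0 hα hτ₁ hT
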